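/- **Setting.** "Smooth" means $C^\infty$ over $\mathbb R$. Let $Z$ be a Banach manifold and $\Pi\colon D\to Z$ a Hermitian bundle, i.e. a smooth vector bundle whose fibers $D_z$ are complex Hilbert spaces with scalar products $(\cdot\mid\cdot)_z$ (linear in the first variable), such that $(z,x,y)\mapsto(\Psi(z,x)\mid\Psi(z,y))_z$ is smooth for every local trivialization $\Psi$. For $f,g$ in a Hilbert space write $(f\mid g)$ for the scalar product; $p_{\mathcal S}$ is the orthogonal projection onto a closed subspace $\mathcal S$. *Reproducing kernel.* Let $K$ be a reproducing kernel on $\Pi$: a continuous section $(s,t)\mapsto K(s,t)$, $K(s,t)\colon D_t\to D_s$ bounded linear, of the bundle $\mathrm{Hom}(p_2^*\Pi,p_1^*\Pi)\to Z\times Z$ ($p_1,p_2\colon Z\times Z\to Z$ being the projections) with $\sum_{j,l=1}^n(K(t_l,t_j)\eta_j\mid\eta_l)_{t_l}\ge0$ for all $n\ge 1$, $t_j\in Z$, $\eta_j\in D_{t_j}$. For $\xi\in D$ put $K_\xi:=K(\cdot,\Pi(\xi))\xi$, a section of $\Pi$. Let $\mathcal H^K$ be the Hilbert space of sections of $\Pi$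 obtained by completing $\mathrm{span}\{K_\xi\mid\xi\in D\}$ with respect to $(K_\xi\mid K_\eta)=(K(\Pi(\eta),\Pi(\xi))\xi\mid\eta)_{\Pi(\eta)}$; an element $f\in\mathcal H^K$ has values given by $(f(s)\mid\eta)_s=(f\mid K_\eta)$ for $\eta\in D_s$. Define $\widehat K\colon D\to\mathcal H^K$, $\widehat K(\xi)=K_\xi$, and $\zeta_K\colon Z\to\mathrm{Gr}(\mathcal H^K)$, $\zeta_K(s)=\overline{\widehat K(D_s)}$, where $\mathrm{Gr}(\mathcal H)$ is the Grassmann manifold of all closed subspaces of $\mathcal H$. Assume that $K$ is *admissible*: (a) $K$ is a smooth section; (b) $K(s,s)$ is invertible for every $s\in Z$; (c) $\zeta_K$ is smooth. *Universal connection.* Let $\mathcal H=\mathcal H^K$, let $\mathcal S_0\subseteq\mathcal H$ be a closed subspace, let $\mathrm{Gr}_{\mathcal S_0}(\mathcal H)=\{u\mathcal S_0\mid u\in U(\mathcal H)\}$, and assume $\zeta_K(Z)\subseteq\mathrm{Gr}_{\mathcal S_0}(\mathcal H)$. Let $\mathcal T_{\mathcal S_0}(\mathcal H)=\{(\mathcal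 S,x)\mid\mathcal S\in\mathrm{Gr}_{\mathcal S_0}(\mathcal H),\,x\in\mathcal S\}\to\mathrm{Gr}_{\mathcal S_0}(\mathcal H)$ be the tautological bundle. For $u\in U(\mathcal H)$, $X\in\mathcal B(\mathcal H)$ with $X^*=-X$, and $x,y\in\mathcal S_0$, let $[((u,X),(x,y))]$ be the velocity at $t=0$ of the path $t\mapsto\bigl(u e^{tX}\mathcal S_0,\ u e^{tX}(x+ty)\bigr)$ in $\mathcal T_{\mathcal S_0}(\mathcal H)$; every tangent vector of $\mathcal T_{\mathcal S_0}(\mathcal H)$ is of this form. With $p=p_{\mathcal S_0}$ and $E_p(X)=pXp+(1-p)X(1-p)$, the universal connection is $\Phi_{\mathcal S_0}\colon[((u,X),(x,y))]\mapsto[((u,E_p(X)),(x,y))]$ on $T(\mathcal T_{\mathcal S_0}(\mathcal H))$. *Induced connection.* Let $\delta_K=(\zeta_K\circ\Pi,\widehat K)\colon D\to\mathcal T_{\mathcal S_0}(\mathcal H^K)$, a fiberwise isomorphism. The connection $\Phi_K\colon TD\to TD$ induced by $K$ is the pull-back of $\Phi_{\mathcal S_0}$ through $(\delta_K,\zeta_K)$: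 on $T_\xi D$ it equals $(T_\xi\delta_K|_{\mathcal V_\xi D})^{-1}\circ\Phi_{\mathcal S_0}\circ T_\xi\delta_K$, where $\mathcal V D=\mathrm{Ker}(T\Pi)\subseteq TD$ is the vertical part. Let $r\colon\mathcal V D\to D$ send the velocity at $t=0$ of the path $t\mapsto x_1+tx_2$ ($x_1,x_2$ in one fiber) to $x_2$. The covariant derivative of a smooth section $\sigma$ is $\nabla\sigma:=r\circ\Phi_K\circ T\sigma\colon TZ\to D$. **Theorem.** Let $\sigma$ be a smooth section of $\Pi$ over an open set $W\subseteq Z$ for which there is a smooth section $\widetilde\sigma$ of $\mathcal T_{\mathcal S_0}(\mathcal H^K)\to\mathrm{Gr}_{\mathcal S_0}(\mathcal H^K)$ over an open set $V\subseteq\mathrm{Gr}_{\mathcal S_0}(\mathcal H^K)$ such that $\delta_K\circ\sigma=\widetilde\sigma\circ\zeta_K$ on $W\cap\zeta_K^{-1}(V)$. Then for every $s\in W\cap\zeta_K^{-1}(V)$ and every $X\in T_sZ$ the map $\widehat K\circ\sigma$ (from $W$ to $\mathcal H^K$) is differentiable at $s$, and $$(\nabla\sigma)(X)=K(s,s)^{-1}\Bigl(\bigl(p_{\zeta_K(s)}(\mathrm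 d(\widehat K\circ\sigma)(X))\bigr)(s)\Bigr)\in D_s .$$ -/

import Mathlib

open Bundle Manifold Topology Filter Set
open scoped ContDiff ComplexOrder InnerProductSpace

set_option linter.unusedSectionVars false

noncomputable section
namespace KernelConnection

section Kernel

/-- A reproducing kernel on a complex vector bundle `D → Z` whose fibers are Hilbert spaces: a
section `K(s, t) : D_t → D_s` of the bundle `Hom(p₂^* D, p₁^* D) → Z × Z` which is continuous (that
is, continuous in local trivializations, for the operator norm) and positive definite. The scalar
product `(x | y)` of the fibers, linear in `x`, is Mathlib's `⟪y, x⟫_ℂ`. -/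
structure ReproducingKernel (F : Type*) [NormedAddCommGroup F] [InnerProductSpace ℂ F]
    {Z : Type*} [TopologicalSpace Z] (D : Z → Type*) [TopologicalSpace (TotalSpace F D)]
    [∀ z, NormedAddCommGroup (D z)] [∀ z, InnerProductSpace ℂ (D z)]
    [FiberBundle F D] [VectorBundle ℂ F D] where
  toFun : ∀ s t : Z, D t →L[ℂ] D s
  continuous_toFun : ∀ s₀ t₀ : Z, ContinuousAt
    (fun p : Z × Z ↦ ContinuousLinearMap.inCoordinates F D F D t₀ p.2 s₀ p.1 (toFun p.1 p.2))
    (s₀, t₀)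
  posDef : ∀ (n : ℕ) (t : Fin n → Z) (η : ∀ j, D (t j)),
    0 ≤ ∑ j, ∑ l, ⟪η l, toFun (t l) (t j) (η j)⟫_ℂ

variable {F : Type*} [NormedAddCommGroup F] [InnerProductSpace ℂ F]
  {Z : Type*} [TopologicalSpace Z] {D : Z → Type*} [TopologicalSpace (TotalSpace F D)]
  [∀ z, NormedAddCommGroup (D z)] [∀ z, InnerProductSpace ℂ (D z)]
  [FiberBundle F D] [VectorBundle ℂ F D]

namespace ReproducingKernel

instance : CoeFun (ReproducingKernel F D) (fun _ ↦ ∀ s t : Z, D t →L[ℂ] D s) := ⟨toFun⟩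

variable (K : ReproducingKernel F D)

/-- The section `K_ξ = K(·, Π(ξ)) ξ`. -/
def kernelSection (ξ : TotalSpace F D) : ∀ s, D s := fun s ↦ K s ξ.proj ξ.snd

/-- The linear span of the sections `K_ξ`. -/
def PreSpace : Type _ := ↥(Submodule.span ℂ (Set.range K.kernelSection))

instance : AddCommGroup K.PreSpace := inferInstanceAs
  (AddCommGroup ↥(Submodule.span ℂ (Set.range K.kernelSection)))

instance : Module ℂ K.PreSpace := inferInstanceAs
  (Module ℂ ↥(Submodule.span ℂ (Set.range K.kernelSection)))

/-- Elements of the span are sections. -/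
def PreSpace.val {K : ReproducingKernel F D} : K.PreSpace →ₗ[ℂ] (∀ s, D s) :=
  (Submodule.span ℂ (Set.range K.kernelSection)).subtype

/-- A section in the span, as an element of the span. -/
def PreSpace.mk {K : ReproducingKernel F D} (f : ∀ s, D s)
    (hf : f ∈ Submodule.span ℂ (Set.range K.kernelSection)) : K.PreSpace := ⟨f, hf⟩

/-- `K_ξ` as an element of the span. -/
def preFeature (ξ : TotalSpace F D) : K.PreSpace :=
  PreSpace.mk (K.kernelSection ξ) (Submodule.subset_span ⟨ξ, rfl⟩)

theorem PreSpace.val_injective : Function.Injective (PreSpace.val (K := K)) :=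
  Subtype.val_injective

/-- The linear combination of kernel sections with given coefficients. -/
def comb : (TotalSpace F D →₀ ℂ) →ₗ[ℂ] (∀ s, D s) :=
  Finsupp.linearCombination ℂ K.kernelSection

theorem exists_comb (f : K.PreSpace) : ∃ c, K.comb c = f.val :=
  (Finsupp.mem_span_range_iff_exists_finsupp.1 f.2).imp fun _ hc ↦ hc

/-- Coefficients of an element of the span with respect to the spanning family `K_ξ`. -/
def coeffs (f : K.PreSpace) : TotalSpace F D →₀ ℂ := (K.exists_comb f).choose

theorem comb_coeffs (f : K.PreSpace) : K.comb (K.coeffs f) = f.val := (K.exists_comb f).choose_spec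

/-- The pairing of a linear combination `∑ c_η K_η` with a section `f`, extending
`(f | K_η) = (f(Π(η)) | η)`. -/
def pairing (c : TotalSpace F D →₀ ℂ) (f : ∀ s, D s) : ℂ :=
  c.sum fun η a ↦ star a * ⟪η.snd, f η.proj⟫_ℂ

theorem pairing_add_left (c c' : TotalSpace F D →₀ ℂ) (f : ∀ s, D s) :
    pairing (c + c') f = pairing c f + pairing c' f :=
  Finsupp.sum_add_index' (by simp) (by simp [add_mul])

theorem pairing_smul_left (a : ℂ) (c : TotalSpace F D →₀ ℂ) (f : ∀ s, D s) :
    pairing (a • c) f = star a * pairing c f := by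
  simp [pairing, Finsupp.sum_smul_index, Finsupp.mul_sum, mul_assoc]

theorem pairing_add_right (c : TotalSpace F D →₀ ℂ) (f g : ∀ s, D s) :
    pairing c (f + g) = pairing c f + pairing c g := by
  simp [pairing, mul_add, Finsupp.sum_add]

theorem pairing_smul_right (a : ℂ) (c : TotalSpace F D →₀ ℂ) (f : ∀ s, D s) :
    pairing c (a • f) = a * pairing c f := by
  simp [pairing, Finsupp.mul_sum, mul_left_comm]

theorem pairing_single (η : TotalSpace F D) (f : ∀ s, D s) :
    pairing (Finsupp.single η 1) f = ⟪η.snd, f η.proj⟫_ℂ := by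
  simp [pairing]

theorem pairing_comb_nonneg (c : TotalSpace F D →₀ ℂ) : 0 ≤ pairing c (K.comb c) := by
  classical
  have h := K.posDef c.support.card (fun j ↦ (c.support.equivFin.symm j).1.proj)
    (fun j ↦ c (c.support.equivFin.symm j).1 • (c.support.equivFin.symm j).1.snd)
  have e : pairing c (K.comb c) = ∑ η ∈ c.support, ∑ ξ ∈ c.support,
      ⟪c η • η.snd, K η.proj ξ.proj (c ξ • ξ.snd)⟫_ℂ := by
    simp only [pairing, Finsupp.sum, comb, Finsupp.linearCombination_apply, Finset.sum_apply,
      Pi.smul_apply, inner_sum, inner_smul_right, inner_smul_left, map_smul, kernelSection,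
      Finset.mul_sum]
    refine Finset.sum_congr rfl fun η _ ↦ Finset.sum_congr rfl fun ξ _ ↦ ?_
    simp
    ring
  rw [e, Finset.sum_comm]
  convert h using 1
  rw [← Finset.sum_coe_sort, ← c.support.equivFin.symm.sum_comp]
  refine Finset.sum_congr rfl fun j _ ↦ ?_
  rw [← Finset.sum_coe_sort, ← c.support.equivFin.symm.sum_comp]

theorem pairing_comb_symm (c b : TotalSpace F D →₀ ℂ) :
    star (pairing b (K.comb c)) = pairing c (K.comb b) := by
  have im0 : ∀ c, (pairing c (K.comb c)).im = 0 := fun c ↦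
    ((Complex.le_def.1 (K.pairing_comb_nonneg c)).2).symm
  have h1 := im0 (c + b)
  have h2 := im0 (c + Complex.I • b)
  simp only [map_add, map_smul, pairing_add_left, pairing_add_right, pairing_smul_left,
    pairing_smul_right, Complex.add_im, im0] at h1 h2
  simp [im0] at h1 h2
  apply Complex.ext
  · simp; linarith
  · simp; linarith

theorem pairing_coeffs_symm (f g : K.PreSpace) :
    pairing (K.coeffs f) g.val = star (pairing (K.coeffs g) f.val) := by
  rw [← K.comb_coeffs f, ← K.comb_coeffs g, K.pairing_comb_symm]

/-- The form on the span determined by `(K_ξ | K_η) = (K(Π(η), Π(ξ)) ξ | η)`. Recall that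
`⟪g, f⟫_ℂ = (f | g)`, Mathlib inner products being conjugate linear in the first variable. -/
@[reducible] def preCore : PreInnerProductSpace.Core ℂ K.PreSpace where
  inner g f := pairing (K.coeffs g) f.val
  conj_inner_symm g f := (K.pairing_coeffs_symm g f).symm
  re_inner_nonneg f := by
    have := K.pairing_comb_nonneg (K.coeffs f)
    rw [K.comb_coeffs f] at this
    exact (Complex.le_def.1 this).1
  add_left f g h := by
    rw [pairing_coeffs_symm, K.pairing_coeffs_symm f, K.pairing_coeffs_symm g, map_add,
      pairing_add_right, star_add]
  smul_left f h a := by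
    rw [pairing_coeffs_symm, K.pairing_coeffs_symm f, map_smul, pairing_smul_right, star_mul']
    rfl

theorem pairing_coeffs_preFeature (f : K.PreSpace) (ξ : TotalSpace F D) :
    pairing (K.coeffs (K.preFeature ξ)) f.val = ⟪ξ.snd, f.val ξ.proj⟫_ℂ := by
  have h : (K.preFeature ξ).val = K.comb (Finsupp.single ξ 1) := by
    rw [comb, Finsupp.linearCombination_single, one_smul]
    rfl
  rw [pairing_coeffs_symm, h, ← K.comb_coeffs f, pairing_comb_symm, pairing_single]

/-- The inner product on the span of the sections `K_ξ`. -/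
@[reducible] def innerCore : InnerProductSpace.Core ℂ K.PreSpace where
  toCore := K.preCore
  definite f hf := by
    apply PreSpace.val_injective
    rw [map_zero]
    funext t
    have h := @InnerProductSpace.Core.inner_mul_inner_self_le ℂ K.PreSpace _ _ _ K.preCore
      (K.preFeature ⟨t, f.val t⟩) f
    have e : @inner ℂ K.PreSpace K.preCore.toInner (K.preFeature ⟨t, f.val t⟩) f
        = ⟪f.val t, f.val t⟫_ℂ := K.pairing_coeffs_preFeature f ⟨t, f.val t⟩
    have hf' : @inner ℂ K.PreSpace K.preCore.toInner f f = 0 := hf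
    rw [e, hf', ← @InnerProductSpace.Core.inner_conj_symm ℂ K.PreSpace _ _ _ K.preCore, e] at h
    simp only [map_zero, mul_zero] at h
    have h2 : ‖⟪f.val t, f.val t⟫_ℂ‖ * ‖⟪f.val t, f.val t⟫_ℂ‖ ≤ 0 := by
      simpa using h
    have h3 : ‖⟪f.val t, f.val t⟫_ℂ‖ = 0 := by
      nlinarith [norm_nonneg ⟪f.val t, f.val t⟫_ℂ]
    simpa using h3

instance : NormedAddCommGroup K.PreSpace := K.innerCore.toNormedAddCommGroup

instance : InnerProductSpace ℂ K.PreSpace := .ofCore K.innerCore.toCore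

theorem inner_preFeature (ξ : TotalSpace F D) (f : K.PreSpace) :
    ⟪K.preFeature ξ, f⟫_ℂ = ⟪ξ.snd, f.val ξ.proj⟫_ℂ := K.pairing_coeffs_preFeature f ξ

/-- The reproducing kernel Hilbert space `H^K`: the completion of the span of the sections `K_ξ`
with respect to the inner product determined by `(K_ξ | K_η) = (K(Π(η), Π(ξ)) ξ | η)`. -/
def Space : Type _ := UniformSpace.Completion K.PreSpace

instance : NormedAddCommGroup K.Space :=
  inferInstanceAs (NormedAddCommGroup (UniformSpace.Completion K.PreSpace))

instance : InnerProductSpace ℂ K.Space :=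
  inferInstanceAs (InnerProductSpace ℂ (UniformSpace.Completion K.PreSpace))

instance : CompleteSpace K.Space :=
  inferInstanceAs (CompleteSpace (UniformSpace.Completion K.PreSpace))

/-- The canonical isometric embedding of the span of the sections `K_ξ` into its completion. -/
def ofPre : K.PreSpace →ₗᵢ[ℂ] K.Space := UniformSpace.Completion.toComplₗᵢ

theorem denseRange_ofPre : DenseRange K.ofPre := UniformSpace.Completion.denseRange_coe

/-- The map `K̂ : D → H^K`, `ξ ↦ K_ξ`. -/
def feature (ξ : TotalSpace F D) : K.Space := K.ofPre (K.preFeature ξ)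

theorem inner_feature (ξ η : TotalSpace F D) :
    ⟪K.feature η, K.feature ξ⟫_ℂ = ⟪η.snd, K η.proj ξ.proj ξ.snd⟫_ℂ := by
  rw [feature, feature, LinearIsometry.inner_map_map, inner_preFeature]
  rfl

/-- The restriction of the feature map to the fiber `D_s`, a bounded linear operator. -/
def fiberFeature (s : Z) : D s →L[ℂ] K.Space :=
  LinearMap.mkContinuous
    { toFun := fun x ↦ K.feature ⟨s, x⟩
      map_add' := fun x y ↦ by
        have : K.preFeature ⟨s, x + y⟩ = K.preFeature ⟨s, x⟩ + K.preFeature ⟨s, y⟩ := by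
          apply PreSpace.val_injective
          rw [map_add]
          funext t
          exact map_add (K t s) x y
        simp only [feature, this, map_add]
      map_smul' := fun a x ↦ by
        have : K.preFeature ⟨s, a • x⟩ = a • K.preFeature ⟨s, x⟩ := by
          apply PreSpace.val_injective
          rw [map_smul]
          funext t
          exact map_smul (K t s) a x
        simp only [feature, this, map_smul, RingHom.id_apply] }
    (Real.sqrt ‖K s s‖) (fun x ↦ by
      have h : ‖K.feature ⟨s, x⟩‖ ^ 2 ≤ ‖K s s‖ * ‖x‖ ^ 2 := by
        rw [← inner_self_eq_norm_sq (𝕜 := ℂ), inner_feature]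
        calc _ ≤ ‖x‖ * ‖K s s x‖ := (RCLike.re_le_norm _).trans (norm_inner_le_norm _ _)
          _ ≤ ‖x‖ * (‖K s s‖ * ‖x‖) := by gcongr; exact (K s s).le_opNorm x
          _ = _ := by ring
      have := Real.sqrt_le_sqrt h
      rwa [Real.sqrt_sq (norm_nonneg _), Real.sqrt_mul (norm_nonneg _),
        Real.sqrt_sq (norm_nonneg _)] at this)

theorem fiberFeature_apply (s : Z) (x : D s) : K.fiberFeature s x = K.feature ⟨s, x⟩ := rfl

/-- Evaluation at `s` of the elements of `H^K`, regarded as sections of the bundle: the continuous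
operator `f ↦ f(s)` characterized by `(f(s) | η) = (f | K_η)` for `η ∈ D_s`. It extends evaluation
on the span of the sections `K_ξ` (`eval_ofPre`), and an element of `H^K` is determined by its
values (`eval_ext`). -/
def eval [∀ z, CompleteSpace (D z)] (s : Z) : K.Space →L[ℂ] D s :=
  ContinuousLinearMap.adjoint (K.fiberFeature s)

theorem eval_ofPre [∀ z, CompleteSpace (D z)] (s : Z) (f : K.PreSpace) :
    K.eval s (K.ofPre f) = f.val s := by
  refine ext_inner_left ℂ fun x ↦ ?_
  rw [eval, ContinuousLinearMap.adjoint_inner_right, fiberFeature_apply, feature,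
    LinearIsometry.inner_map_map, inner_preFeature]

theorem eval_ext [∀ z, CompleteSpace (D z)] {f g : K.Space} (h : ∀ s, K.eval s f = K.eval s g) :
    f = g := by
  rw [← sub_eq_zero]
  refine K.denseRange_ofPre.eq_zero_of_inner_right ℂ fun a ↦ ?_
  have key : ∀ x ∈ Submodule.span ℂ (Set.range K.kernelSection),
      ∀ hx, ⟪K.ofPre (PreSpace.mk x hx), f - g⟫_ℂ = 0 := by
    intro x hx
    induction hx using Submodule.span_induction with
    | mem x h' =>
      obtain ⟨ξ, rfl⟩ := h'
      intro hx
      have := h ξ.proj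
      rw [← sub_eq_zero, ← map_sub] at this
      have h2 : ⟪ξ.snd, K.eval ξ.proj (f - g)⟫_ℂ = 0 := by rw [this, inner_zero_right]
      rwa [eval, ContinuousLinearMap.adjoint_inner_right] at h2
    | zero =>
      intro hx
      have : PreSpace.mk (K := K) 0 hx = 0 := rfl
      rw [this, map_zero, inner_zero_left]
    | add x y hx hy ihx ihy =>
      intro hxy
      have : PreSpace.mk (x + y) hxy = PreSpace.mk (K := K) x hx + PreSpace.mk y hy := rfl
      rw [this, map_add, inner_add_left, ihx, ihy, add_zero]
    | smul c x hx ih =>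
      intro hcx
      have : PreSpace.mk (c • x) hcx = c • PreSpace.mk (K := K) x hx := rfl
      rw [this, map_smul, inner_smul_left, ih, mul_zero]
  exact key a.1 a.2 a.2

/-- The subspace `ζ_K(s)`, the closure of `K̂(D_s)` in `H^K`. -/
def classifyingSubspace (s : Z) : Submodule ℂ K.Space :=
  (LinearMap.range (K.fiberFeature s : D s →ₗ[ℂ] K.Space)).topologicalClosure

instance (s : Z) : CompleteSpace (K.classifyingSubspace s) :=
  (Submodule.isClosed_topologicalClosure _).completeSpace_coe

end ReproducingKernel
end Kernel

section Grassmannian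

theorem exists_unitary_mul_unit {A : Type*} [CStarAlgebra A] [PartialOrder A] [StarOrderedRing A]
    (N : A) (hN : star N = -N) : ∃ u ∈ unitary A, ∃ h : Aˣ, 1 + N = u * h ∧
      ∀ p : A, Commute (N * N) p → Commute (h : A) p := by
  have ha0 : (0 : A) ≤ star N * N := star_mul_self_nonneg N
  have ha1 : IsStrictlyPositive (1 + star N * N) := isStrictlyPositive_one.add_nonneg ha0
  have ha : (0 : A) ≤ 1 + star N * N := ha1.nonneg
  set a := 1 + star N * N with hadef
  have ha' : a = 1 - N * N := by rw [hadef, hN]; noncomm_ring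
  obtain ⟨h, hh⟩ := (CFC.isUnit_sqrt_iff a ha).2 ha1.isUnit
  have hsq : (h : A) * h = a := by rw [hh]; exact CFC.sqrt_mul_sqrt_self a ha
  have hsa : star (h : A) = h := by rw [hh]; exact (CFC.sqrt_nonneg a).isSelfAdjoint
  have hcomm : ∀ p : A, Commute (N * N) p → Commute (h : A) p := by
    intro p hp
    rw [hh, CFC.sqrt]
    refine Commute.cfcₙ_nnreal ?_ _
    rw [ha']
    exact (Commute.one_left p).sub_left hp
  have hNh : (h : A) * N = N * h := hcomm N ((Commute.refl N).mul_left (Commute.refl N))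
  have hinvN : (↑h⁻¹ : A) * N = N * ↑h⁻¹ := by
    rw [Units.inv_mul_eq_iff_eq_mul, ← mul_assoc, hNh, mul_assoc, Units.mul_inv, mul_one]
  have hsinv : star (↑h⁻¹ : A) = ↑h⁻¹ := by
    have : star h = h := Units.ext hsa
    rw [← Units.coe_star, star_inv, this]
  have hg : (1 + N) * (1 - N) = h * h := by rw [hsq, ha']; noncomm_ring
  have hg' : (1 - N) * (1 + N) = h * h := by rw [hsq, ha']; noncomm_ring
  refine ⟨(1 + N) * ↑h⁻¹, ?_, h, by simp, hcomm⟩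
  have hs : star ((1 + N) * (↑h⁻¹ : A)) = ↑h⁻¹ * (1 - N) := by
    rw [star_mul, hsinv, star_add, star_one, hN, sub_eq_add_neg]
  rw [Unitary.mem_iff, hs]
  constructor
  · calc (↑h⁻¹ : A) * (1 - N) * ((1 + N) * ↑h⁻¹) = ↑h⁻¹ * ((1 - N) * (1 + N)) * ↑h⁻¹ := by
          simp only [mul_assoc]
      _ = 1 := by rw [hg']; simp
  · have e : (↑h⁻¹ : A) * (1 - N) = (1 - N) * ↑h⁻¹ := by
      rw [mul_sub, sub_mul, hinvN]; simp
    rw [e]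
    have e2 : (1 + N) * (↑h⁻¹ : A) = ↑h⁻¹ * (1 + N) := by
      rw [mul_add, add_mul, hinvN]; simp
    rw [e2]
    calc (↑h⁻¹ : A) * (1 + N) * ((1 - N) * ↑h⁻¹) = ↑h⁻¹ * ((1 + N) * (1 - N)) * ↑h⁻¹ := by
          simp only [mul_assoc]
      _ = 1 := by rw [hg]; simp

variable {H : Type*} [NormedAddCommGroup H] [InnerProductSpace ℂ H] [CompleteSpace H]
variable (S₀ : Submodule ℂ H) [CompleteSpace S₀]

/-- The map `x ↦ x + T x` parametrizing the graph of `T : S₀ → S₀ᗮ`. -/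
def graphMap (T : S₀ →L[ℂ] S₀ᗮ) : S₀ →L[ℂ] H := S₀.subtypeL + S₀ᗮ.subtypeL ∘L T

theorem exists_unitary_map_eq_graph (T : S₀ →L[ℂ] S₀ᗮ) : ∃ u : unitary (H →L[ℂ] H),
    S₀.map (u : H →L[ℂ] H).toLinearMap = LinearMap.range (graphMap S₀ T).toLinearMap := by
  let A : H →L[ℂ] H := S₀ᗮ.subtypeL ∘L T ∘L S₀.orthogonalProjectionOnto
  let p : H →L[ℂ] H := S₀.starProjection
  have hp : star p = p := isSelfAdjoint_starProjection S₀
  have hAp : A * p = A := by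
    ext x
    have : S₀.orthogonalProjectionOnto (S₀.starProjection x) = S₀.orthogonalProjectionOnto x := by
      rw [Submodule.starProjection_apply]
      exact S₀.orthogonalProjectionOnto_mem_subspace_eq_self _
    simp [A, p, this]
  have hpA : p * A = 0 := by
    ext x
    exact (Submodule.starProjection_apply_eq_zero_iff S₀).2 (T _).2
  have hsA : star A * p = 0 := by
    have := congrArg star hpA
    rwa [star_mul, hp, star_zero] at this
  have hpsA : p * star A = star A := by
    have := congrArg star hAp
    rwa [star_mul, hp] at this
  have hAA : A * A = 0 := by
    nth_rewrite 1 [← hAp]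
    rw [mul_assoc, hpA, mul_zero]
  have hsAA : star A * star A = 0 := by rw [← star_mul, hAA, star_zero]
  obtain ⟨u, hu, h, he, hc⟩ := exists_unitary_mul_unit (A - star A) (by simp)
  have hcp : Commute (h : H →L[ℂ] H) p := by
    refine hc p ?_
    have e : (A - star A) * (A - star A) = -(A * star A) - star A * A := by
      rw [sub_mul, mul_sub, mul_sub, hAA, hsAA]; abel
    rw [e]
    change _ * p = p * _
    rw [sub_mul, mul_sub, neg_mul, mul_neg, mul_assoc, hsA, mul_zero, ← mul_assoc p A, hpA,
      zero_mul, mul_assoc, hAp, ← mul_assoc, hpsA]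
  have hcp' : Commute (↑h⁻¹ : H →L[ℂ] H) p := hcp.units_inv_left
  have key : ∀ x ∈ S₀, (1 + (A - star A)) x = x + A x := by
    intro x hx
    have : star A x = 0 := by
      have h1 : star A (p x) = 0 := congrArg (fun B : H →L[ℂ] H ↦ B x) hsA
      rwa [Submodule.starProjection_eq_self_iff.2 hx] at h1
    simp [this]
  have mem : ∀ B : H →L[ℂ] H, Commute B p → ∀ x ∈ S₀, B x ∈ S₀ := by
    intro B hB x hx
    rw [← Submodule.starProjection_eq_self_iff] at hx ⊢
    have : B (p x) = p (B x) := congrArg (fun C : H →L[ℂ] H ↦ C x) hB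
    rw [hx] at this
    exact this.symm
  have hu1 : ∀ x ∈ S₀, u (h.1 x) = graphMap S₀ T (S₀.orthogonalProjectionOnto x) := by
    intro x hx
    have : (u * h.1) x = x + A x := by rw [← he, key x hx]
    rw [mul_apply_eq_comp] at this
    rw [this]
    simp [graphMap, A, Submodule.starProjection_eq_self_iff.2 hx]
  refine ⟨⟨u, hu⟩, le_antisymm ?_ ?_⟩
  · rintro _ ⟨x, hx, rfl⟩
    have hx' := mem _ hcp' x hx
    refine ⟨S₀.orthogonalProjectionOnto ((↑h⁻¹ : H →L[ℂ] H) x), ?_⟩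
    have h1 := hu1 _ hx'
    have h2 : h.1 ((↑h⁻¹ : H →L[ℂ] H) x) = x :=
      congrArg (fun C : H →L[ℂ] H ↦ C x) h.mul_inv
    rw [h2] at h1
    exact h1.symm
  · rintro _ ⟨y, rfl⟩
    refine ⟨h.1 y, mem _ hcp y y.2, ?_⟩
    have h1 := hu1 y y.2
    rw [Submodule.orthogonalProjectionOnto_mem_subspace_eq_self] at h1
    exact h1

/-- `S` is the graph of a bounded operator `S₀ → S₀ᗮ`, that is, the orthogonal projection of `S`
to `S₀` is invertible. For closed `S₀` and `S`, these `S` form the domain of the standard chart of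
the Grassmann manifold around `S₀`. -/
def IsGraphOver (S : Submodule ℂ H) : Prop :=
  (S₀.orthogonalProjectionOnto ∘L S.subtypeL).IsInvertible

/-- The operator `S₀ → S₀ᗮ` whose graph is `S`, the standard chart of the Grassmann manifold
around `S₀`. -/
def graphCoord (S : Submodule ℂ H) : S₀ →L[ℂ] S₀ᗮ :=
  (S₀ᗮ.orthogonalProjectionOnto ∘L S.subtypeL) ∘L
    (S₀.orthogonalProjectionOnto ∘L S.subtypeL).inverse

variable {S₀} in
theorem isGraphOver_iff {S : Submodule ℂ H} {A : S₀ →L[ℂ] H} (e : S₀ ≃L[ℂ] S)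
    (he : S.subtypeL ∘L (e : S₀ →L[ℂ] S) = A) :
    IsGraphOver S₀ S ↔ (S₀.orthogonalProjectionOnto ∘L A).IsInvertible := by
  rw [← he, ← ContinuousLinearMap.comp_assoc, ContinuousLinearMap.isInvertible_comp_equiv]
  rfl

variable {S₀} in
theorem graphCoord_eq {S : Submodule ℂ H} {A : S₀ →L[ℂ] H} (e : S₀ ≃L[ℂ] S)
    (he : S.subtypeL ∘L (e : S₀ →L[ℂ] S) = A) :
    graphCoord S₀ S = (S₀ᗮ.orthogonalProjectionOnto ∘L A) ∘L
      (S₀.orthogonalProjectionOnto ∘L A).inverse := by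
  rw [← he, ← ContinuousLinearMap.comp_assoc, ← ContinuousLinearMap.comp_assoc,
    ContinuousLinearMap.inverse_comp_equiv]
  ext x
  simp [graphCoord]

/-- The graph of `T`. -/
def graph (T : S₀ →L[ℂ] S₀ᗮ) : Submodule ℂ H := LinearMap.range (graphMap S₀ T).toLinearMap

theorem proj_graphMap (T : S₀ →L[ℂ] S₀ᗮ) :
    S₀.orthogonalProjectionOnto ∘L graphMap S₀ T = ContinuousLinearMap.id ℂ S₀ := by
  ext x
  simp [graphMap, Submodule.orthogonalProjectionOnto_apply_of_mem_orthogonal (T x).2]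

theorem proj_orthogonal_graphMap (T : S₀ →L[ℂ] S₀ᗮ) :
    S₀ᗮ.orthogonalProjectionOnto ∘L graphMap S₀ T = T := by
  ext x
  simp [graphMap]

/-- The parametrization of the graph of `T`. -/
def graphEquiv (T : S₀ →L[ℂ] S₀ᗮ) : S₀ ≃L[ℂ] graph S₀ T :=
  ContinuousLinearEquiv.equivOfInverse
    ((graphMap S₀ T).codRestrict (graph S₀ T) (fun x ↦ ⟨x, rfl⟩))
    (S₀.orthogonalProjectionOnto ∘L (graph S₀ T).subtypeL)
    (fun x ↦ congrArg (fun B : S₀ →L[ℂ] S₀ ↦ B x) (proj_graphMap S₀ T))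
    (by
      rintro ⟨_, y, rfl⟩
      apply Subtype.ext
      have := congrArg (fun B : S₀ →L[ℂ] S₀ ↦ B y) (proj_graphMap S₀ T)
      exact congrArg (graphMap S₀ T) this)

/-- The image `u S` of a subspace under a unitary operator. -/
def unitaryMap (u : unitary (H →L[ℂ] H)) (S : Submodule ℂ H) : Submodule ℂ H :=
  S.map (u : H →L[ℂ] H).toLinearMap

theorem unitaryMap_mul (u v : unitary (H →L[ℂ] H)) (S : Submodule ℂ H) :
    unitaryMap (u * v) S = unitaryMap u (unitaryMap v S) :=
  Submodule.map_comp _ _ _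

theorem unitaryMap_one (S : Submodule ℂ H) : unitaryMap 1 S = S := Submodule.map_id _

/-- A unitary operator restricts to an isomorphism of `S` onto `u S`. -/
def unitaryEquiv (u : unitary (H →L[ℂ] H)) (S : Submodule ℂ H) : S ≃L[ℂ] unitaryMap u S :=
  ContinuousLinearEquiv.equivOfInverse
    (((u : H →L[ℂ] H) ∘L S.subtypeL).codRestrict _ (fun x ↦ ⟨x, x.2, rfl⟩))
    ((((u⁻¹ : unitary (H →L[ℂ] H)) : H →L[ℂ] H) ∘L (unitaryMap u S).subtypeL).codRestrict S (by
      rintro ⟨_, x, hx, rfl⟩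
      have : (((u⁻¹ * u : unitary (H →L[ℂ] H)) : H →L[ℂ] H)) x = x := by simp
      exact this.symm ▸ hx))
    (fun x ↦ by
      apply Subtype.ext
      have : (((u⁻¹ * u : unitary (H →L[ℂ] H)) : H →L[ℂ] H)) x = x := by simp
      exact this)
    (fun x ↦ by
      apply Subtype.ext
      have : (((u * u⁻¹ : unitary (H →L[ℂ] H)) : H →L[ℂ] H)) x = x := by
        rw [mul_inv_cancel]; rfl
      exact this)

/-- The component `Gr_{S₀}(H) = {u S₀ | u ∈ U(H)}` of the Grassmann manifold of `H`. -/
@[ext]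
structure GrassmannComponent where
  space : Submodule ℂ H
  exists_unitary : ∃ u : unitary (H →L[ℂ] H), space = unitaryMap u S₀

namespace GrassmannComponent

variable {S₀}

/-- The action of the unitary group on `Gr_{S₀}(H)`. -/
def act (u : unitary (H →L[ℂ] H)) (S : GrassmannComponent S₀) : GrassmannComponent S₀ :=
  ⟨unitaryMap u S.1, S.2.imp' (u * ·) fun v hv ↦ by rw [hv, unitaryMap_mul]⟩

theorem act_mul (u v : unitary (H →L[ℂ] H)) (S : GrassmannComponent S₀) :
    act (u * v) S = act u (act v S) := GrassmannComponent.ext (unitaryMap_mul u v S.1)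

theorem act_one (S : GrassmannComponent S₀) : act 1 S = S := GrassmannComponent.ext (unitaryMap_one S.1)

theorem act_inv_act (u : unitary (H →L[ℂ] H)) (S : GrassmannComponent S₀) :
    act u⁻¹ (act u S) = S := by rw [← act_mul, inv_mul_cancel, act_one]

theorem act_act_inv (u : unitary (H →L[ℂ] H)) (S : GrassmannComponent S₀) :
    act u (act u⁻¹ S) = S := by rw [← act_mul, mul_inv_cancel, act_one]

/-- The graph of `T` as a point of `Gr_{S₀}(H)`. -/
def ofGraph (T : S₀ →L[ℂ] S₀ᗮ) : GrassmannComponent S₀ :=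
  ⟨graph S₀ T, (exists_unitary_map_eq_graph S₀ T).imp fun _ h ↦ h.symm⟩

/-- `S₀` as a point of `Gr_{S₀}(H)`. -/
def base : GrassmannComponent S₀ := ⟨S₀, 1, (unitaryMap_one S₀).symm⟩

theorem isGraphOver_base : IsGraphOver S₀ (base (S₀ := S₀)).1 := by
  have : S₀.orthogonalProjectionOnto ∘L S₀.subtypeL = ContinuousLinearEquiv.refl ℂ S₀ := by
    ext x
    simp
  exact ⟨_, this.symm⟩

theorem graphCoord_ofGraph (T : S₀ →L[ℂ] S₀ᗮ) : graphCoord S₀ (ofGraph T).1 = T := by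
  have h := graphCoord_eq (A := graphMap S₀ T) (graphEquiv S₀ T) rfl
  rw [proj_graphMap, proj_orthogonal_graphMap, ContinuousLinearMap.inverse_id] at h
  exact h

theorem isGraphOver_ofGraph (T : S₀ →L[ℂ] S₀ᗮ) : IsGraphOver S₀ (ofGraph T).1 := by
  have h := isGraphOver_iff (A := graphMap S₀ T) (graphEquiv S₀ T) rfl
  rw [proj_graphMap] at h
  exact h.2 (ContinuousLinearMap.isInvertible_equiv (f := ContinuousLinearEquiv.refl ℂ S₀))

theorem graphMap_graphCoord {S : Submodule ℂ H} (hS : IsGraphOver S₀ S) (x : S) :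
    graphMap S₀ (graphCoord S₀ S) (S₀.orthogonalProjectionOnto x) = x := by
  have h : (S₀.orthogonalProjectionOnto ∘L S.subtypeL).inverse (S₀.orthogonalProjectionOnto x) = x :=
    ContinuousLinearMap.IsInvertible.inverse_apply_self hS x
  simp only [graphMap, graphCoord, add_apply, ContinuousLinearMap.comp_apply, h]
  exact S₀.starProjection_add_starProjection_orthogonal x

theorem ofGraph_graphCoord {S : GrassmannComponent S₀} (hS : IsGraphOver S₀ S.1) :
    ofGraph (graphCoord S₀ S.1) = S := by
  apply GrassmannComponent.ext
  apply le_antisymm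
  · rintro _ ⟨y, rfl⟩
    obtain ⟨x, rfl⟩ := ContinuousLinearMap.IsInvertible.surjective hS y
    have := graphMap_graphCoord hS x
    exact this.symm ▸ x.2
  · intro x hx
    exact ⟨S₀.orthogonalProjectionOnto x, graphMap_graphCoord hS ⟨x, hx⟩⟩

/-- The chart `S ↦ graphCoord (u⁻¹ S)` of `Gr_{S₀}(H)` around `u S₀`. -/
def chart (u : unitary (H →L[ℂ] H)) : PartialEquiv (GrassmannComponent S₀) (S₀ →L[ℂ] S₀ᗮ) where
  toFun S := graphCoord S₀ (act u⁻¹ S).1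
  invFun T := act u (ofGraph T)
  source := {S | IsGraphOver S₀ (act u⁻¹ S).1}
  target := univ
  map_source' _ _ := mem_univ _
  map_target' T _ := by
    rw [mem_ofPred_eq, act_inv_act]
    exact isGraphOver_ofGraph T
  left_inv' S hS := by rw [ofGraph_graphCoord hS, act_act_inv]
  right_inv' T _ := by rw [act_inv_act, graphCoord_ofGraph]

/-- The parametrization of `v⁻¹ u (graph T)` by `S₀`. -/
def transitionMap (u v : unitary (H →L[ℂ] H)) (T : S₀ →L[ℂ] S₀ᗮ) : S₀ →L[ℂ] H :=
  ((v⁻¹ * u : unitary (H →L[ℂ] H)) : H →L[ℂ] H) ∘L graphMap S₀ T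

theorem contDiff_transitionMap (u v : unitary (H →L[ℂ] H)) :
    ContDiff ℂ ω (transitionMap (S₀ := S₀) u v) := by
  unfold transitionMap graphMap
  fun_prop

theorem chart_symm_trans_source (u v : unitary (H →L[ℂ] H)) :
    ((chart (S₀ := S₀) u).symm.trans (chart v)).source
      = {T | (S₀.orthogonalProjectionOnto ∘L transitionMap u v T).IsInvertible} := by
  ext T
  have := isGraphOver_iff (A := transitionMap u v T)
    ((graphEquiv S₀ T).trans (unitaryEquiv (v⁻¹ * u) (graph S₀ T))) rfl
  simp only [PartialEquiv.trans_source, mem_inter_iff, mem_preimage]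
  simp only [chart, PartialEquiv.symm_source, mem_univ, true_and, mem_ofPred_eq]
  rw [← this]
  change IsGraphOver S₀ (act v⁻¹ (act u (ofGraph T))).1 ↔ _
  rw [← act_mul]
  rfl

theorem chart_symm_trans_apply (u v : unitary (H →L[ℂ] H)) (T : S₀ →L[ℂ] S₀ᗮ) :
    ((chart (S₀ := S₀) u).symm.trans (chart v)) T
      = (S₀ᗮ.orthogonalProjectionOnto ∘L transitionMap u v T) ∘L
        (S₀.orthogonalProjectionOnto ∘L transitionMap u v T).inverse := by
  have := graphCoord_eq (A := transitionMap u v T)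
    ((graphEquiv S₀ T).trans (unitaryEquiv (v⁻¹ * u) (graph S₀ T))) rfl
  rw [← this]
  change graphCoord S₀ (act v⁻¹ (act u (ofGraph T))).1 = _
  rw [← act_mul]
  rfl

theorem isOpen_chart_symm_trans_source (u v : unitary (H →L[ℂ] H)) :
    IsOpen ((chart (S₀ := S₀) u).symm.trans (chart v)).source := by
  rw [chart_symm_trans_source]
  have h : IsOpen (range ((↑) : (S₀ ≃L[ℂ] S₀) → S₀ →L[ℂ] S₀)) := ContinuousLinearEquiv.isOpen
  exact h.preimage (continuous_const.clm_comp (contDiff_transitionMap u v).continuous)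

theorem contDiffOn_chart_symm_trans (u v : unitary (H →L[ℂ] H)) :
    ContDiffOn ℂ ω ((chart (S₀ := S₀) u).symm.trans (chart v))
      ((chart (S₀ := S₀) u).symm.trans (chart v)).source := by
  intro T hT
  rw [chart_symm_trans_source] at hT
  apply ContDiffAt.contDiffWithinAt
  rw [show ⇑((chart (S₀ := S₀) u).symm.trans (chart v)) = _ from
    funext (chart_symm_trans_apply u v)]
  have h1 : ContDiffAt ℂ ω (fun T ↦ S₀.orthogonalProjectionOnto ∘L transitionMap u v T) T :=
    contDiffAt_const.clm_comp (contDiff_transitionMap u v).contDiffAt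
  have h2 : ContDiffAt ℂ ω (fun T ↦ S₀ᗮ.orthogonalProjectionOnto ∘L transitionMap u v T) T :=
    contDiffAt_const.clm_comp (contDiff_transitionMap u v).contDiffAt
  exact h2.clm_comp (ContDiffAt.comp (g := ContinuousLinearMap.inverse)
    (f := fun T ↦ S₀.orthogonalProjectionOnto ∘L transitionMap u v T) T
    (ContinuousLinearMap.IsInvertible.contDiffAt_map_inverse hT) h1)

/-- The atlas of the component `Gr_{S₀}(H)`, with model space the bounded operators
`S₀ → S₀ᗮ`. -/
def core : ChartedSpaceCore (S₀ →L[ℂ] S₀ᗮ) (GrassmannComponent S₀) where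
  atlas := range chart
  chartAt S := chart S.2.choose
  mem_chart_source S := by
    have h : act S.2.choose⁻¹ S = base := by
      have : S = act S.2.choose base := GrassmannComponent.ext S.2.choose_spec
      generalize S.2.choose = u at this ⊢
      rw [this, act_inv_act]
    change IsGraphOver S₀ (act S.2.choose⁻¹ S).1
    rw [h]
    exact isGraphOver_base
  chart_mem_atlas S := ⟨_, rfl⟩
  open_source := by
    rintro _ _ ⟨u, rfl⟩ ⟨v, rfl⟩
    exact isOpen_chart_symm_trans_source u v
  continuousOn_toFun := by
    rintro _ _ ⟨u, rfl⟩ ⟨v, rfl⟩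
    exact (contDiffOn_chart_symm_trans u v).continuousOn

instance : TopologicalSpace (GrassmannComponent S₀) := core.toTopologicalSpace

instance : ChartedSpace (S₀ →L[ℂ] S₀ᗮ) (GrassmannComponent S₀) := core.toChartedSpace

theorem exists_chart_of_mem_atlas {e : OpenPartialHomeomorph (GrassmannComponent S₀) (S₀ →L[ℂ] S₀ᗮ)}
    (he : e ∈ atlas (S₀ →L[ℂ] S₀ᗮ) (GrassmannComponent S₀)) :
    ∃ u, e.toPartialEquiv = chart u := by
  obtain ⟨_, ⟨e, rfl⟩, _, ⟨⟨u, rfl⟩, rfl⟩, rfl⟩ := he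
  exact ⟨u, rfl⟩

instance : IsManifold 𝓘(ℂ, S₀ →L[ℂ] S₀ᗮ) ω (GrassmannComponent S₀) := by
  apply isManifold_of_contDiffOn
  intro e e' he he'
  obtain ⟨u, hu⟩ := exists_chart_of_mem_atlas he
  obtain ⟨v, hv⟩ := exists_chart_of_mem_atlas he'
  have := contDiffOn_chart_symm_trans (S₀ := S₀) u v
  rw [← hu, ← hv] at this
  simpa using this

instance : IsManifold 𝓘(ℝ, S₀ →L[ℂ] S₀ᗮ) ∞ (GrassmannComponent S₀) := by
  apply isManifold_of_contDiffOn
  intro e e' he he'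
  obtain ⟨u, hu⟩ := exists_chart_of_mem_atlas he
  obtain ⟨v, hv⟩ := exists_chart_of_mem_atlas he'
  have := ((contDiffOn_chart_symm_trans (S₀ := S₀) u v).restrict_scalars ℝ).of_le
    (m := ∞) le_top
  rw [← hu, ← hv] at this
  simpa using this

/-- The fibers of the tautological bundle `T_{S₀}(H) → Gr_{S₀}(H)`: the fiber over the point `S`
is the subspace `S` itself. -/
abbrev Taut (S : GrassmannComponent S₀) : Type _ := ↥S.space

theorem completeSpace_space (S : GrassmannComponent S₀) : CompleteSpace S.space := by
  obtain ⟨u, hu⟩ := S.exists_unitary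
  rw [hu]
  exact (unitaryEquiv u S₀).isUniformEmbedding.isUniformInducing.completeSpace_congr
    (unitaryEquiv u S₀).surjective |>.1 inferInstance

/-- The operator `x ↦ p_{S₀} u⁻¹ x` from the fiber `S` to the model fiber `S₀`. -/
def fiberMap (u : unitary (H →L[ℂ] H)) (S : GrassmannComponent S₀) : Taut S →L[ℂ] S₀ :=
  S₀.orthogonalProjectionOnto ∘L ((u⁻¹ : unitary (H →L[ℂ] H)) : H →L[ℂ] H) ∘L S.space.subtypeL

theorem isInvertible_fiberMap {u : unitary (H →L[ℂ] H)} {S : GrassmannComponent S₀}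
    (h : S ∈ (chart u).source) : (fiberMap u S).IsInvertible := by
  have : fiberMap u S = (S₀.orthogonalProjectionOnto ∘L (act u⁻¹ S).space.subtypeL) ∘L
    (unitaryEquiv u⁻¹ S.space : S.space →L[ℂ] unitaryMap u⁻¹ S.space) := rfl
  rw [this]
  exact ContinuousLinearMap.IsInvertible.comp h ⟨unitaryEquiv u⁻¹ S.space, rfl⟩

theorem mem_chart_source_choose (S : GrassmannComponent S₀) :
    S ∈ (chart S.exists_unitary.choose).source := core.mem_chart_source S

/-- The chart at `u S₀` as an open partial homeomorphism. -/
def chartHomeo (u : unitary (H →L[ℂ] H)) :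
    OpenPartialHomeomorph (GrassmannComponent S₀) (S₀ →L[ℂ] S₀ᗮ) :=
  core.openPartialHomeomorph (chart u) ⟨u, rfl⟩

theorem chartHomeo_mem_atlas (u : unitary (H →L[ℂ] H)) :
    chartHomeo u ∈ atlas (S₀ →L[ℂ] S₀ᗮ) (GrassmannComponent S₀) :=
  mem_iUnion.2 ⟨chart u, mem_iUnion.2 ⟨⟨u, rfl⟩, rfl⟩⟩

/-- The trivialization `(S, x) ↦ (S, p_{S₀} u⁻¹ x)` of the tautological bundle over the domain of
the chart at `u S₀`. -/
def pretriv (u : unitary (H →L[ℂ] H)) :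
    Pretrivialization S₀ (TotalSpace.proj : TotalSpace S₀ (Taut (S₀ := S₀)) → _) where
  toFun ξ := (ξ.proj, fiberMap u ξ.proj ξ.snd)
  invFun q := ⟨q.1, (fiberMap u q.1).inverse q.2⟩
  source := TotalSpace.proj ⁻¹' (chart u).source
  target := (chart u).source ×ˢ univ
  map_source' _ h := ⟨h, mem_univ _⟩
  map_target' _ h := h.1
  left_inv' := by
    rintro ⟨S, x⟩ h
    exact congrArg (TotalSpace.mk S) ((isInvertible_fiberMap h).inverse_apply_self x)
  right_inv' := by
    rintro ⟨S, y⟩ h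
    exact Prod.ext rfl ((isInvertible_fiberMap h.1).self_apply_inverse y)
  open_target := (chartHomeo u).open_source.prod isOpen_univ
  baseSet := (chart u).source
  open_baseSet := (chartHomeo u).open_source
  source_eq := rfl
  target_eq := rfl
  proj_toFun _ _ := rfl

theorem pretriv_symm (u : unitary (H →L[ℂ] H)) {S : GrassmannComponent S₀}
    (hS : S ∈ (chart u).source) (y : S₀) :
    (pretriv u).symm S y = (fiberMap u S).inverse y := by
  have := (pretriv u).mk_symm (b := S) hS y
  exact eq_of_heq (TotalSpace.mk.inj this).2

theorem coordChange_eq (u v : unitary (H →L[ℂ] H)) {S : GrassmannComponent S₀}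
    (hS : S ∈ (chart u).source) (y : S₀) :
    (S₀.orthogonalProjectionOnto ∘L transitionMap u v (chart u S)) y
      = fiberMap v S ((fiberMap u S).inverse y) := by
  obtain ⟨x, rfl⟩ := (isInvertible_fiberMap hS).surjective y
  rw [(isInvertible_fiberMap hS).inverse_apply_self]
  have h := graphMap_graphCoord hS (unitaryEquiv u⁻¹ S.space x)
  have h1 : graphMap S₀ (chart u S) (fiberMap u S x)
      = ((u⁻¹ : unitary (H →L[ℂ] H)) : H →L[ℂ] H) (x : H) := h
  have h2 : transitionMap u v (chart u S) (fiberMap u S x)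
      = ((v⁻¹ * u * u⁻¹ : unitary (H →L[ℂ] H)) : H →L[ℂ] H) (x : H) := by
    rw [transitionMap, ContinuousLinearMap.comp_apply, h1]
    rfl
  rw [ContinuousLinearMap.comp_apply, h2, mul_inv_cancel_right]
  rfl

theorem contMDiffOn_coordChange (u v : unitary (H →L[ℂ] H)) :
    ContMDiffOn 𝓘(ℂ, S₀ →L[ℂ] S₀ᗮ) 𝓘(ℂ, S₀ →L[ℂ] S₀) ω
      (fun S : GrassmannComponent S₀ ↦
        S₀.orthogonalProjectionOnto ∘L transitionMap u v (chart u S)) (chart u).source := by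
  have h1 : ContDiff ℂ ω (fun T ↦ S₀.orthogonalProjectionOnto ∘L transitionMap (S₀ := S₀) u v T) :=
    contDiff_const.clm_comp (contDiff_transitionMap u v)
  have h2 : ContMDiffOn 𝓘(ℂ, S₀ →L[ℂ] S₀ᗮ) 𝓘(ℂ, S₀ →L[ℂ] S₀ᗮ) ω
      (chartHomeo (S₀ := S₀) u) (chartHomeo (S₀ := S₀) u).source :=
    contMDiffOn_of_mem_maximalAtlas
      (IsManifold.subset_maximalAtlas (chartHomeo_mem_atlas u))
  exact h1.contMDiff.comp_contMDiffOn h2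

/-- The vector bundle structure of the tautological bundle. -/
def prebundle : VectorPrebundle ℂ S₀ (Taut (S₀ := S₀)) where
  pretrivializationAtlas := range pretriv
  pretrivialization_linear' := by
    rintro _ ⟨u, rfl⟩
    exact ⟨fun S _ ↦ (fiberMap u S).toLinearMap.isLinear⟩
  pretrivializationAt S := pretriv S.exists_unitary.choose
  mem_base_pretrivializationAt := mem_chart_source_choose
  pretrivialization_mem_atlas S := ⟨_, rfl⟩
  exists_coordChange := by
    rintro _ ⟨u, rfl⟩ _ ⟨v, rfl⟩
    refine ⟨fun S ↦ S₀.orthogonalProjectionOnto ∘L transitionMap u v (chart u S),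
      (contMDiffOn_coordChange u v).continuousOn.mono inter_subset_left, ?_⟩
    rintro S ⟨hS, -⟩ y
    rw [pretriv_symm u hS, coordChange_eq u v hS]
    rfl
  totalSpaceMk_isInducing S := by
    obtain ⟨e, he⟩ := isInvertible_fiberMap (mem_chart_source_choose S)
    have : (pretriv S.exists_unitary.choose ∘ TotalSpace.mk S) = (fun y ↦ (S, y)) ∘ e := by
      funext x
      exact Prod.ext rfl (congrArg (fun B : Taut S →L[ℂ] S₀ ↦ B x) he.symm)
    rw [this]
    exact (isInducing_prodMkRight S).comp e.toHomeomorph.isInducing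

instance : TopologicalSpace (TotalSpace S₀ (Taut (S₀ := S₀))) := prebundle.totalSpaceTopology

instance : FiberBundle S₀ (Taut (S₀ := S₀)) := prebundle.toFiberBundle

instance : VectorBundle ℂ S₀ (Taut (S₀ := S₀)) := prebundle.toVectorBundle

instance : prebundle.IsContMDiff (E := Taut (S₀ := S₀)) 𝓘(ℂ, S₀ →L[ℂ] S₀ᗮ) ω where
  exists_contMDiffCoordChange := by
    rintro _ ⟨u, rfl⟩ _ ⟨v, rfl⟩
    refine ⟨fun S ↦ S₀.orthogonalProjectionOnto ∘L transitionMap u v (chart u S),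
      (contMDiffOn_coordChange u v).mono inter_subset_left, ?_⟩
    rintro S ⟨hS, -⟩ y
    rw [pretriv_symm u hS, coordChange_eq u v hS]
    rfl

instance : ContMDiffVectorBundle ω S₀ (Taut (S₀ := S₀)) 𝓘(ℂ, S₀ →L[ℂ] S₀ᗮ) :=
  prebundle.contMDiffVectorBundle _

end GrassmannComponent

end Grassmannian

section Connection

/-- The pull-back of a connection `Φ'` on `φ' : M' → Z'` through a bundle homomorphism
`δ : M → M'` which is a fiberwise diffeomorphism: the restriction of `Φ` to the tangent space at
`x` is `(T_x δ|_{V_x})⁻¹ ∘ Φ' ∘ T_x δ`, where `V_x = Ker (T_x φ)` is the space of vertical vectors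
at `x` for `φ : M → Z`. -/
def pullbackConnection {E₁ H₁ M E₂ H₂ Z E₃ H₃ M' : Type*}
    [NormedAddCommGroup E₁] [NormedSpace ℝ E₁] [TopologicalSpace H₁] (I₁ : ModelWithCorners ℝ E₁ H₁)
    [TopologicalSpace M] [ChartedSpace H₁ M]
    [NormedAddCommGroup E₂] [NormedSpace ℝ E₂] [TopologicalSpace H₂] (I₂ : ModelWithCorners ℝ E₂ H₂)
    [TopologicalSpace Z] [ChartedSpace H₂ Z]
    [NormedAddCommGroup E₃] [NormedSpace ℝ E₃] [TopologicalSpace H₃] (I₃ : ModelWithCorners ℝ E₃ H₃)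
    [TopologicalSpace M'] [ChartedSpace H₃ M']
    (φ : M → Z) (δ : M → M') (Φ' : TangentBundle I₃ M' → TangentBundle I₃ M') :
    TangentBundle I₁ M → TangentBundle I₁ M := fun v ↦
  haveI : Nonempty (TangentBundle I₁ M) := ⟨v⟩
  Function.invFunOn (tangentMap I₁ I₃ δ)
    {w | w.proj = v.proj ∧ (tangentMap I₁ I₂ φ w).snd = 0} (Φ' (tangentMap I₁ I₃ δ v))

section CovariantDerivative

variable {EZ : Type*} [NormedAddCommGroup EZ] [NormedSpace ℝ EZ]
  {Z : Type*} [TopologicalSpace Z] [ChartedSpace EZ Z]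
  {F : Type*} [NormedAddCommGroup F] [InnerProductSpace ℂ F]
  {D : Z → Type*} [TopologicalSpace (TotalSpace F D)]
  [∀ z, NormedAddCommGroup (D z)] [∀ z, InnerProductSpace ℂ (D z)] [FiberBundle F D]

variable (EZ F D) in
/-- The map `ε` from the fibered product `D ×_Z D` to the vertical part of `TD`, sending
`(x₁, x₂)` to the velocity at `t = 0` of the path `t ↦ x₁ + t x₂`. -/
def verticalLift (p : Σ z, D z × D z) : TangentBundle (𝓘(ℝ, EZ).prod 𝓘(ℝ, F)) (TotalSpace F D) :=
  tangentMap 𝓘(ℝ, ℝ) (𝓘(ℝ, EZ).prod 𝓘(ℝ, F))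
    (fun t : ℝ ↦ (⟨p.1, p.2.1 + t • p.2.2⟩ : TotalSpace F D)) ⟨0, (1 : ℝ)⟩

/-- The natural map `r` from the vertical part of `TD` to `D`, `r (ε (x₁, x₂)) = x₂`. -/
def verticalProj (w : TangentBundle (𝓘(ℝ, EZ).prod 𝓘(ℝ, F)) (TotalSpace F D)) : TotalSpace F D :=
  haveI : Nonempty (Σ z, D z × D z) := ⟨⟨w.proj.proj, 0, 0⟩⟩
  ⟨(Function.invFun (verticalLift EZ F D) w).1, (Function.invFun (verticalLift EZ F D) w).2.2⟩

/-- The covariant derivative `∇σ = r ∘ Φ ∘ Tσ : TZ → D` of a section `σ` of `D → Z` for a linear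
connection `Φ : TD → TD`. -/
def covariantDerivative
    (Φ : TangentBundle (𝓘(ℝ, EZ).prod 𝓘(ℝ, F)) (TotalSpace F D) →
      TangentBundle (𝓘(ℝ, EZ).prod 𝓘(ℝ, F)) (TotalSpace F D))
    (σ : ∀ z, D z) (v : TangentBundle 𝓘(ℝ, EZ) Z) : TotalSpace F D :=
  verticalProj (Φ (tangentMap 𝓘(ℝ, EZ) (𝓘(ℝ, EZ).prod 𝓘(ℝ, F))
    (fun z ↦ (⟨z, σ z⟩ : TotalSpace F D)) v))

variable (EZ F D) in
/-- The inner products of the fibers of `D → Z` form a Hermitian structure: in every local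
trivialization `Ψ` of the atlas, `(z, x, y) ↦ (Ψ(z, x) | Ψ(z, y))_z` is smooth. -/
def IsHermitianBundle : Prop :=
  ∀ e : Trivialization F (TotalSpace.proj : TotalSpace F D → Z), e ∈ trivializationAtlas F D →
    ContMDiffOn (𝓘(ℝ, EZ).prod (𝓘(ℝ, F).prod 𝓘(ℝ, F))) 𝓘(ℝ, ℂ) ∞
      (fun p : Z × F × F ↦ ⟪e.symm p.1 p.2.2, e.symm p.1 p.2.1⟫_ℂ) (e.baseSet ×ˢ univ)

/-- A map from `Z` to the Grassmann manifold of all closed subspaces of `H` is smooth: near every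
point `s₀` it takes values in the domain of the standard chart around its value at `s₀`, and it is
smooth in this chart. -/
def IsSmoothIntoGrassmannian (EZ : Type*) [NormedAddCommGroup EZ] [NormedSpace ℝ EZ]
    {Z : Type*} [TopologicalSpace Z] [ChartedSpace EZ Z]
    {H : Type*} [NormedAddCommGroup H] [InnerProductSpace ℂ H] [CompleteSpace H]
    (ζ : Z → Submodule ℂ H) [∀ s, CompleteSpace (ζ s)] : Prop :=
  ∀ s₀, (∀ᶠ s in 𝓝 s₀, IsGraphOver (ζ s₀) (ζ s)) ∧
    ContMDiffAt 𝓘(ℝ, EZ) 𝓘(ℝ, ζ s₀ →L[ℂ] (ζ s₀)ᗮ) ∞ (fun s ↦ graphCoord (ζ s₀) (ζ s)) s₀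

end CovariantDerivative

section Universal

variable {H : Type*} [NormedAddCommGroup H] [InnerProductSpace ℂ H] [CompleteSpace H]
variable (S₀ : Submodule ℂ H) [CompleteSpace S₀]

/-- The exponential map from the skew-adjoint operators to the unitary operators. -/
def unitaryExp (X : skewAdjoint (H →L[ℂ] H)) : unitary (H →L[ℂ] H) :=
  ⟨NormedSpace.exp (X : H →L[ℂ] H), by
    letI : NormedAlgebra ℚ (H →L[ℂ] H) := .restrictScalars ℚ ℂ (H →L[ℂ] H)
    exact NormedSpace.exp_mem_unitary_of_mem_skewAdjoint X.2⟩

/-- The operator `E_p(X) = p X p + (1 - p) X (1 - p)`, where `p` is the orthogonal projection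
onto `S₀`. -/
def condExpectation (X : skewAdjoint (H →L[ℂ] H)) : skewAdjoint (H →L[ℂ] H) :=
  ⟨S₀.starProjection * X * S₀.starProjection
      + (1 - S₀.starProjection) * X * (1 - S₀.starProjection), by
    have hp : star S₀.starProjection = S₀.starProjection := isSelfAdjoint_starProjection S₀
    have hX : star (X : H →L[ℂ] H) = -X := X.2
    rw [skewAdjoint.mem_iff]
    simp only [star_add, star_mul, star_sub, star_one, hp, hX]
    noncomm_ring⟩

/-- The point `(u S₀, u x)` of the tautological bundle, the image of `[(u, x)]` under the
identification of `U(H) ×_{U(p)} S₀` with the tautological bundle. -/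
def homPoint (u : unitary (H →L[ℂ] H)) (x : S₀) :
    TotalSpace S₀ (GrassmannComponent.Taut (S₀ := S₀)) :=
  ⟨GrassmannComponent.act u GrassmannComponent.base, unitaryEquiv u S₀ x⟩

/-- The tangent vector `[((u, X), (x, y))]` to the tautological bundle: the velocity at `t = 0` of
the path `t ↦ [(u exp(tX), x + t y)]`. -/
def homTangent (q : unitary (H →L[ℂ] H) × skewAdjoint (H →L[ℂ] H) × S₀ × S₀) :
    TangentBundle (𝓘(ℝ, S₀ →L[ℂ] S₀ᗮ).prod 𝓘(ℝ, S₀))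
      (TotalSpace S₀ (GrassmannComponent.Taut (S₀ := S₀))) :=
  tangentMap 𝓘(ℝ, ℝ) (𝓘(ℝ, S₀ →L[ℂ] S₀ᗮ).prod 𝓘(ℝ, S₀))
    (fun t : ℝ ↦ homPoint S₀ (q.1 * unitaryExp (t • q.2.1)) (q.2.2.1 + t • q.2.2.2)) ⟨0, (1 : ℝ)⟩

/-- The universal connection on the tautological bundle,
`[((u, X), (x, y))] ↦ [((u, E_p(X)), (x, y))]`. -/
def universalConnection
    (w : TangentBundle (𝓘(ℝ, S₀ →L[ℂ] S₀ᗮ).prod 𝓘(ℝ, S₀))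
      (TotalSpace S₀ (GrassmannComponent.Taut (S₀ := S₀)))) :
    TangentBundle (𝓘(ℝ, S₀ →L[ℂ] S₀ᗮ).prod 𝓘(ℝ, S₀))
      (TotalSpace S₀ (GrassmannComponent.Taut (S₀ := S₀))) :=
  homTangent S₀ ((Function.invFun (homTangent S₀) w).1,
    condExpectation S₀ (Function.invFun (homTangent S₀) w).2.1,
    (Function.invFun (homTangent S₀) w).2.2)

end Universal

namespace ReproducingKernel

variable {EZ : Type*} [NormedAddCommGroup EZ] [NormedSpace ℝ EZ]
  {Z : Type*} [TopologicalSpace Z] [ChartedSpace EZ Z]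
  {F : Type*} [NormedAddCommGroup F] [InnerProductSpace ℂ F]
  {D : Z → Type*} [TopologicalSpace (TotalSpace F D)]
  [∀ z, NormedAddCommGroup (D z)] [∀ z, InnerProductSpace ℂ (D z)]
  [FiberBundle F D] [VectorBundle ℂ F D] (K : ReproducingKernel F D)

variable (EZ) in
/-- Admissible reproducing kernels: `K` is smooth as a section of `Hom(p₂^* D, p₁^* D)` (in local
trivializations), every `K(s, s)` is invertible, and the map `ζ_K` from `Z` to the Grassmann
manifold of `H^K` is smooth. -/
structure IsAdmissible : Prop where
  contMDiff : ∀ s₀ t₀ : Z, ContMDiffAt (𝓘(ℝ, EZ).prod 𝓘(ℝ, EZ)) 𝓘(ℝ, F →L[ℂ] F) ∞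
    (fun p : Z × Z ↦ ContinuousLinearMap.inCoordinates F D F D t₀ p.2 s₀ p.1 (K p.1 p.2))
    (s₀, t₀)
  isInvertible : ∀ s, (K s s).IsInvertible
  smooth_classifying : IsSmoothIntoGrassmannian EZ K.classifyingSubspace

variable (S₀ : Submodule ℂ K.Space) [CompleteSpace S₀]
  (hS₀ : ∀ s, ∃ u : unitary (K.Space →L[ℂ] K.Space), K.classifyingSubspace s = unitaryMap u S₀)

/-- The map `ζ_K`, with values in the component `Gr_{S₀}(H^K)`. -/
def classifyingBase (s : Z) : GrassmannComponent S₀ := ⟨K.classifyingSubspace s, hS₀ s⟩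

/-- The map `δ_K = (ζ_K ∘ Π, K̂)` from `D` to the tautological bundle over `Gr_{S₀}(H^K)`. -/
def classifyingMap (ξ : TotalSpace F D) : TotalSpace S₀ (GrassmannComponent.Taut (S₀ := S₀)) :=
  ⟨K.classifyingBase S₀ hS₀ ξ.proj,
    ⟨K.feature ξ,
      subset_closure (LinearMap.mem_range_self (K.fiberFeature ξ.proj).toLinearMap ξ.snd)⟩⟩

variable (EZ) in
/-- The connection on `D` induced by `K`: the pull-back of the universal connection through the
classifying morphism `(δ_K, ζ_K)`. -/
def inducedConnection : TangentBundle (𝓘(ℝ, EZ).prod 𝓘(ℝ, F)) (TotalSpace F D) →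
    TangentBundle (𝓘(ℝ, EZ).prod 𝓘(ℝ, F)) (TotalSpace F D) :=
  pullbackConnection (𝓘(ℝ, EZ).prod 𝓘(ℝ, F)) 𝓘(ℝ, EZ) (𝓘(ℝ, S₀ →L[ℂ] S₀ᗮ).prod 𝓘(ℝ, S₀))
    TotalSpace.proj (K.classifyingMap S₀ hS₀) (universalConnection S₀)

variable (EZ) in
/-- The differential `d(K̂ ∘ σ)` at `s` of the `H^K`-valued function `K̂ ∘ σ`. -/
def dFeature (σ : ∀ z, D z) (s : Z) : TangentSpace 𝓘(ℝ, EZ) s →L[ℝ] K.Space :=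
  mfderiv 𝓘(ℝ, EZ) 𝓘(ℝ, K.Space) (fun z ↦ K.feature ⟨z, σ z⟩) s

end ReproducingKernel

end Connection

end KernelConnection
end

open KernelConnection

/-!
The tautological bundle over `Gr_{S₀}(H)` comes with the map `ι : (S, x) ↦ x` into `H`. In the chart
at `S = u S₀` it reads `(T, y) ↦ u (y + T y)`, so a tangent vector at a point over `S` is determined
by its image in the tangent space of the base and its image under `dι`
(`GrassmannComponent.tangentBundle_ext`). On the vector `[((u, X), (x, y))]` the differential `dι`
takes the value `u (X x + y)`. Replacing `X` by `E_p(X)` makes the base component vanish and changes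
this value to `u (p X x + y)`, which is the orthogonal projection of `u (X x + y)` to `u S₀`. Hence
the universal connection sends `w`, at a point over `S`, to the vertical vector at the same point
whose image under `dι` is `p_S (dι w)` (`mfderiv_proj_universalConnection`,
`mfderiv_inclusion_universalConnection`).

The map `K̂` is `ι ∘ δ_K`. Because `K̂_s* K̂_t = K(s, t)`, one has `K̂_s K(s, s)⁻¹ K̂_s* = p_{ζ_K(s)}`
(`ReproducingKernel.fiberFeature_inverse_eval`). This gives the differentiability of `δ_K`, and with
it that of `K̂`, since the fiber coordinate of `δ_K` near a point over `s` depends on `ξ` only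
through `K(s, Π(ξ)) ξ`. A vertical vector at `ξ` is the velocity of `t ↦ ξ + t b`, and its image
under `dK̂` is `K̂ b`. So the induced connection sends `w ∈ T_ξ D`, `s = Π(ξ)`, to the velocity of
`t ↦ ξ + t b` with `K̂ b = p_{ζ_K(s)} (dK̂ w)`, that is, `b = K(s, s)⁻¹ ((p_{ζ_K(s)} (dK̂ w))(s))`
(`ReproducingKernel.inducedConnection_eq`). The formula for `∇σ` is the case `w = Tσ(X)`.
-/

noncomputable section
namespace KernelConnection

/-! ### Tangent spaces of fiber bundles in the preferred charts -/

section FiberBundle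

variable {EB : Type*} [NormedAddCommGroup EB] [NormedSpace ℝ EB]
  {B : Type*} [TopologicalSpace B] [ChartedSpace EB B]
  {F : Type*} [NormedAddCommGroup F] [NormedSpace ℝ F]
  {E : B → Type*} [TopologicalSpace (TotalSpace F E)] [∀ x, TopologicalSpace (E x)]
  [FiberBundle F E]

theorem hasMFDerivAt_chartAt_self (x : B) :
    HasMFDerivAt 𝓘(ℝ, EB) 𝓘(ℝ, EB) (chartAt EB x) x (ContinuousLinearMap.id ℝ EB) := by
  refine ⟨(chartAt EB x).continuousAt (mem_chart_source EB x), ?_⟩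
  refine (hasFDerivWithinAt_id _ _).congr_of_eventuallyEq ?_ ?_
  · filter_upwards [extChartAt_target_mem_nhdsWithin (I := 𝓘(ℝ, EB)) x] with y hy
    simp [writtenInExtChartAt] at hy ⊢
    exact (chartAt EB x).right_inv hy
  · simp only [writtenInExtChartAt, mfld_simps]
    rfl

/-- In the coordinates of the tangent space given by the preferred chart, the differential of the
bundle projection is the first component. -/
theorem hasMFDerivAt_proj (ξ : TotalSpace F E) :
    HasMFDerivAt (𝓘(ℝ, EB).prod 𝓘(ℝ, F)) 𝓘(ℝ, EB) (TotalSpace.proj : TotalSpace F E → B) ξ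
      (ContinuousLinearMap.fst ℝ EB F) := by
  refine ⟨(FiberBundle.continuous_proj F E).continuousAt, ?_⟩
  have h : ∀ y ∈ (extChartAt (𝓘(ℝ, EB).prod 𝓘(ℝ, F)) ξ).target,
      writtenInExtChartAt (𝓘(ℝ, EB).prod 𝓘(ℝ, F)) 𝓘(ℝ, EB)
        ξ (TotalSpace.proj : TotalSpace F E → B) y = Prod.fst y := by
    intro y hy
    have h1 := PartialEquiv.right_inv _ hy
    have h2 := (extChartAt (𝓘(ℝ, EB).prod 𝓘(ℝ, F)) ξ).map_target hy
    change chartAt EB ξ.proj ((extChartAt (𝓘(ℝ, EB).prod 𝓘(ℝ, F)) ξ).symm y).proj = y.1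
    generalize (extChartAt (𝓘(ℝ, EB).prod 𝓘(ℝ, F)) ξ).symm y = z at h1 h2
    rw [FiberBundle.extChartAt] at h1 h2
    simp only [mfld_simps] at h2
    rw [← h1, ← Trivialization.coe_fst _ h2.1]
    rfl
  refine (ContinuousLinearMap.fst ℝ EB F).hasFDerivWithinAt.congr_of_eventuallyEq ?_ ?_
  · filter_upwards [extChartAt_target_mem_nhdsWithin (I := 𝓘(ℝ, EB).prod 𝓘(ℝ, F)) ξ] with y hy
    exact h y hy
  · exact h _ (mem_extChartAt_target ξ)

/-- In the coordinates of the tangent space given by the preferred chart, the differential of the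
fiber coordinate is the second component. -/
theorem hasMFDerivAt_trivializationAt_snd (ξ : TotalSpace F E) :
    HasMFDerivAt (𝓘(ℝ, EB).prod 𝓘(ℝ, F)) 𝓘(ℝ, F)
      (fun η : TotalSpace F E ↦ (trivializationAt F E ξ.proj η).2) ξ
      (ContinuousLinearMap.snd ℝ EB F) := by
  refine ⟨continuous_snd.continuousAt.comp ((trivializationAt F E ξ.proj).continuousAt
    (FiberBundle.mem_trivializationAt_proj_source)), ?_⟩
  have h : ∀ y ∈ (extChartAt (𝓘(ℝ, EB).prod 𝓘(ℝ, F)) ξ).target,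
      writtenInExtChartAt (𝓘(ℝ, EB).prod 𝓘(ℝ, F)) 𝓘(ℝ, F)
        ξ (fun η : TotalSpace F E ↦ (trivializationAt F E ξ.proj η).2) y = Prod.snd y := by
    intro y hy
    have h1 := PartialEquiv.right_inv _ hy
    change (trivializationAt F E ξ.proj ((extChartAt (𝓘(ℝ, EB).prod 𝓘(ℝ, F)) ξ).symm y)).2 = y.2
    generalize (extChartAt (𝓘(ℝ, EB).prod 𝓘(ℝ, F)) ξ).symm y = z at h1
    rw [FiberBundle.extChartAt] at h1
    rw [← h1]
    rfl
  refine (ContinuousLinearMap.snd ℝ EB F).hasFDerivWithinAt.congr_of_eventuallyEq ?_ ?_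
  · filter_upwards [extChartAt_target_mem_nhdsWithin (I := 𝓘(ℝ, EB).prod 𝓘(ℝ, F)) ξ] with y hy
    exact h y hy
  · exact h _ (mem_extChartAt_target ξ)

variable {EM : Type*} [NormedAddCommGroup EM] [NormedSpace ℝ EM] {HM : Type*} [TopologicalSpace HM]
  {IM : ModelWithCorners ℝ EM HM} {M : Type*} [TopologicalSpace M] [ChartedSpace HM M]

/-- In the coordinates of the tangent space given by the preferred chart, the differential of a
map to a bundle consists of the differentials of its base part and of its fiber coordinate. -/
theorem hasMFDerivAt_totalSpace {f : M → TotalSpace F E} {x : M} {b : TangentSpace IM x →L[ℝ] EB}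
    {c : TangentSpace IM x →L[ℝ] F}
    (hb : HasMFDerivAt IM 𝓘(ℝ, EB) (fun y ↦ (f y).proj) x b)
    (hc : HasMFDerivAt IM 𝓘(ℝ, F) (fun y ↦ (trivializationAt F E (f x).proj (f y)).2) x c) :
    HasMFDerivAt IM (𝓘(ℝ, EB).prod 𝓘(ℝ, F)) f x (b.prod c) := by
  have hf : MDifferentiableAt IM (𝓘(ℝ, EB).prod 𝓘(ℝ, F)) f x :=
    (mdifferentiableAt_totalSpace _ f).2 ⟨hb.mdifferentiableAt, hc.mdifferentiableAt⟩
  have h1 := hasMFDerivAt_unique ((hasMFDerivAt_proj (f x)).comp x hf.hasMFDerivAt) hb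
  have h2 := hasMFDerivAt_unique
    ((hasMFDerivAt_trivializationAt_snd (f x)).comp x hf.hasMFDerivAt) hc
  have : mfderiv IM (𝓘(ℝ, EB).prod 𝓘(ℝ, F)) f x = b.prod c := by
    ext v
    refine Prod.ext ?_ ?_
    · exact congrArg (fun l : EM →L[ℝ] EB ↦ l v) h1
    · exact congrArg (fun l : EM →L[ℝ] F ↦ l v) h2
  rw [← this]
  exact hf.hasMFDerivAt

end FiberBundle

/-! ### Complex linear operators depending on a point of a real manifold -/

section Operators

variable {EM : Type*} [NormedAddCommGroup EM] [NormedSpace ℝ EM] {HM : Type*} [TopologicalSpace HM]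
  {IM : ModelWithCorners ℝ EM HM} {M : Type*} [TopologicalSpace M] [ChartedSpace HM M]
  {E G F₁ F₂ : Type*} [NormedAddCommGroup E] [NormedSpace ℂ E] [NormedAddCommGroup G]
  [NormedSpace ℂ G] [NormedAddCommGroup F₁] [NormedSpace ℂ F₁] [NormedAddCommGroup F₂]
  [NormedSpace ℂ F₂] {E₁ : Type*} [NormedAddCommGroup E₁] [NormedSpace ℂ E₁]

/-- The differential of `(T, y) ↦ B y + C (T y)` at the point `(0, y)`. -/
def graphDeriv (B : E →L[ℂ] G) (C : F₁ →L[ℂ] G) (y : E) : (E →L[ℂ] F₁) × E →L[ℝ] G :=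
  (B ∘L ContinuousLinearMap.snd ℂ (E →L[ℂ] F₁) E + C ∘L ContinuousLinearMap.apply ℂ F₁ y ∘L
      ContinuousLinearMap.fst ℂ (E →L[ℂ] F₁) E).restrictScalars ℝ

theorem graphDeriv_apply (B : E →L[ℂ] G) (C : F₁ →L[ℂ] G) (y : E) (w : (E →L[ℂ] F₁) × E) :
    graphDeriv B C y w = B w.2 + C (w.1 y) := rfl

theorem hasMFDerivAt_graph (B : E →L[ℂ] G) (C : F₁ →L[ℂ] G) {T : M → E →L[ℂ] F₁} {g : M → E}
    {m : M} {T' : TangentSpace IM m →L[ℝ] (E →L[ℂ] F₁)} {g' : TangentSpace IM m →L[ℝ] E}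
    (hT : HasMFDerivAt IM 𝓘(ℝ, E →L[ℂ] F₁) T m T') (hg : HasMFDerivAt IM 𝓘(ℝ, E) g m g')
    (hT0 : T m = 0) :
    HasMFDerivAt IM 𝓘(ℝ, G) (fun x ↦ B (g x) + C (T x (g x))) m
      ((graphDeriv B C (g m)).comp (T'.prod g') : TangentSpace IM m →L[ℝ] G) := by
  have h5 : HasFDerivAt (fun q : (E →L[ℂ] F₁) × E ↦ q.1 q.2) _
    (T m, g m) := hasFDerivAt_fst.clm_apply (𝕜 := ℂ) hasFDerivAt_snd
  have h6 : HasFDerivAt (fun q : (E →L[ℂ] F₁) × E ↦ B q.2 + C (q.1 q.2)) _ (T m, g m) :=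
    (B.hasFDerivAt.comp _ hasFDerivAt_snd).add (C.hasFDerivAt.comp _ h5)
  have h7 : HasFDerivAt (fun q : (E →L[ℂ] F₁) × E ↦ B q.2 + C (q.1 q.2)) (graphDeriv B C (g m))
      (T m, g m) := by
    refine (h6.restrictScalars ℝ).congr_fderiv ?_
    ext q <;> simp [graphDeriv_apply, hT0]
  have h8 : HasFDerivWithinAt (fun x ↦ (writtenInExtChartAt IM 𝓘(ℝ, E →L[ℂ] F₁) m T x,
      writtenInExtChartAt IM 𝓘(ℝ, E) m g x)) (T'.prod g') (range IM) (extChartAt IM m m) :=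
    hT.2.prodMk hg.2
  have h9 : (writtenInExtChartAt IM 𝓘(ℝ, E →L[ℂ] F₁) m T (extChartAt IM m m),
      writtenInExtChartAt IM 𝓘(ℝ, E) m g (extChartAt IM m m)) = (T m, g m) := by
    simp only [writtenInExtChartAt, mfld_simps]
    rfl
  exact ⟨(h7.continuousAt.comp (f := fun x ↦ (T x, g x)) (hT.1.prodMk hg.1)),
    HasFDerivAt.comp_hasFDerivWithinAt (g := fun q : (E →L[ℂ] F₁) × E ↦ B q.2 + C (q.1 q.2)) _
      (h9.symm ▸ h7) h8⟩

/-- The differential of `A ↦ (Q A) (P A)⁻¹` at a point `A` with `Q A = 0`. -/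
def slopeDeriv (P : G →L[ℂ] F₁) (Q : G →L[ℂ] F₂) (A : E →L[ℂ] G) :
    (E →L[ℂ] G) →L[ℝ] (F₁ →L[ℂ] F₂) :=
  (((ContinuousLinearMap.compL ℂ F₁ E F₂).flip (P ∘L A).inverse) ∘L
    (ContinuousLinearMap.compL ℂ E G F₂ Q)).restrictScalars ℝ

theorem slopeDeriv_apply (P : G →L[ℂ] F₁) (Q : G →L[ℂ] F₂) (A A' : E →L[ℂ] G) :
    slopeDeriv P Q A A' = (Q ∘L A') ∘L (P ∘L A).inverse := rfl

theorem hasMFDerivAt_slope [CompleteSpace E] (P : G →L[ℂ] F₁) (Q : G →L[ℂ] F₂) {A : M → E →L[ℂ] G}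
    {m : M} {A' : TangentSpace IM m →L[ℝ] (E →L[ℂ] G)}
    (hA : HasMFDerivAt IM 𝓘(ℝ, E →L[ℂ] G) A m A') (hP : (P ∘L A m).IsInvertible)
    (hQ : Q ∘L A m = 0) :
    HasMFDerivAt IM 𝓘(ℝ, F₁ →L[ℂ] F₂) (fun x ↦ (Q ∘L A x) ∘L (P ∘L A x).inverse) m
      (slopeDeriv P Q (A m) ∘L A') := by
  have h1 : HasFDerivAt (fun A : E →L[ℂ] G ↦ P ∘L A) (ContinuousLinearMap.compL ℂ E G F₁ P) (A m) :=
    (ContinuousLinearMap.compL ℂ E G F₁ P).hasFDerivAt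
  have h2 : HasFDerivAt (fun A : E →L[ℂ] G ↦ Q ∘L A) (ContinuousLinearMap.compL ℂ E G F₂ Q) (A m) :=
    (ContinuousLinearMap.compL ℂ E G F₂ Q).hasFDerivAt
  have h3 : HasFDerivAt (fun A : E →L[ℂ] G ↦ (P ∘L A).inverse) _ (A m) :=
    ((ContinuousLinearMap.IsInvertible.contDiffAt_map_inverse (n := 1) hP).differentiableAt
    one_ne_zero).hasFDerivAt.comp (A m) h1
  have h4 := (h2.clm_comp h3).restrictScalars ℝ
  have h5 : HasFDerivAt (fun A : E →L[ℂ] G ↦ (Q ∘L A) ∘L (P ∘L A).inverse)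
      (slopeDeriv P Q (A m)) (A m) := by
    refine h4.congr_fderiv ?_
    ext B x
    change (Q ∘L A m) _ + Q (B ((P ∘L A m).inverse x)) = Q (B ((P ∘L A m).inverse x))
    rw [hQ, zero_apply, zero_add]
  exact (hasMFDerivAt_iff_hasFDerivAt.2 h5).comp m hA

theorem mdifferentiableAt_clm_apply {A : M → E →L[ℂ] G} {g : M → E} {m : M}
    (hA : MDifferentiableAt IM 𝓘(ℝ, E →L[ℂ] G) A m) (hg : MDifferentiableAt IM 𝓘(ℝ, E) g m) :
    MDifferentiableAt IM 𝓘(ℝ, G) (fun x ↦ A x (g x)) m := by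
  have h5 : HasFDerivAt (fun q : (E →L[ℂ] G) × E ↦ q.1 q.2) _
    (A m, g m) := hasFDerivAt_fst.clm_apply (𝕜 := ℂ) hasFDerivAt_snd
  exact (mdifferentiableAt_iff_differentiableAt.2
    (h5.restrictScalars ℝ).differentiableAt).comp m (hA.prodMk_space hg)

theorem mdifferentiableAt_affine_comp (B : E →L[ℂ] G) (C : F₁ →L[ℂ] G) (e : E₁ →L[ℂ] E)
    {T : M → E →L[ℂ] F₁} {m : M} (hT : MDifferentiableAt IM 𝓘(ℝ, E →L[ℂ] F₁) T m) :
    MDifferentiableAt IM 𝓘(ℝ, E₁ →L[ℂ] G) (fun x ↦ (B + C ∘L T x) ∘L e) m := by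
  have h1 : Differentiable ℂ (fun T : E →L[ℂ] F₁ ↦ (B + C ∘L T) ∘L e) := by fun_prop
  exact (mdifferentiableAt_iff_differentiableAt.2 ((h1 (T m)).restrictScalars ℝ)).comp m hT

theorem exists_hasMFDerivAt {V : Type*} [NormedAddCommGroup V] [NormedSpace ℝ V]
    {f : ℝ → V} {v : V} {t : ℝ} (h : HasDerivAt f v t) :
    ∃ L : ℝ →L[ℝ] V, HasMFDerivAt 𝓘(ℝ, ℝ) 𝓘(ℝ, V) f t L ∧ L 1 = v :=
  ⟨_, h.hasFDerivAt.hasMFDerivAt, by simp⟩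

theorem exists_hasMFDerivAt_comp_right {U : ℝ → G →L[ℂ] F₁} {U' : G →L[ℂ] F₁} {t : ℝ}
    (h : HasDerivAt U U' t) (B : E →L[ℂ] G) :
    ∃ L : ℝ →L[ℝ] (E →L[ℂ] F₁),
      HasMFDerivAt 𝓘(ℝ, ℝ) 𝓘(ℝ, E →L[ℂ] F₁) (fun s ↦ U s ∘L B) t L ∧ L 1 = U' ∘L B :=
  exists_hasMFDerivAt (HasFDerivAt.comp_hasDerivAt t
    (((ContinuousLinearMap.compL ℂ E G F₁).flip B).restrictScalars ℝ).hasFDerivAt h)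

theorem hasDerivAt_const_add_smul {V : Type*} [NormedAddCommGroup V] [NormedSpace ℝ V] (a b : V) :
    HasDerivAt (fun t : ℝ ↦ a + t • b) b 0 := by
  have h := ((hasDerivAt_id (0 : ℝ)).smul_const b).const_add a
  rw [one_smul] at h
  exact h

end Operators

/-! ### The tautological bundle and its map to the Hilbert space -/

section Tautological

variable {H : Type*} [NormedAddCommGroup H] [InnerProductSpace ℂ H] [CompleteSpace H]
  {S₀ : Submodule ℂ H} [CompleteSpace S₀]

theorem orthogonalProjectionOnto_orthogonal_of_mem {x : H} (hx : x ∈ S₀) :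
    S₀ᗮ.orthogonalProjectionOnto x = 0 :=
  Submodule.orthogonalProjectionOnto_apply_of_mem_orthogonal
    (Submodule.le_orthogonal_orthogonal S₀ hx)

namespace GrassmannComponent

theorem act_inv_eq_base {u : unitary (H →L[ℂ] H)} {S : GrassmannComponent S₀}
    (h : S.space = unitaryMap u S₀) : act u⁻¹ S = base := by
  have : S = act u base := GrassmannComponent.ext h
  rw [this, act_inv_act]

/-- The chart given by `u` is centered at `u S₀`. -/
theorem chart_eq_zero {u : unitary (H →L[ℂ] H)} {S : GrassmannComponent S₀}
    (h : S.space = unitaryMap u S₀) : chart u S = 0 := by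
  change graphCoord S₀ (act u⁻¹ S).1 = 0
  rw [act_inv_eq_base h]
  have : S₀ᗮ.orthogonalProjectionOnto ∘L (base (S₀ := S₀)).space.subtypeL = 0 := by
    ext1 x
    have hx : S₀ᗮ.orthogonalProjectionOnto (x : H) = 0 :=
      orthogonalProjectionOnto_orthogonal_of_mem x.2
    rw [ContinuousLinearMap.comp_apply, zero_apply]
    exact hx
  rw [graphCoord, this, ContinuousLinearMap.zero_comp]

/-- The map `(S, x) ↦ x` in the chart given by `u`. -/
theorem coe_eq_graphMap {u : unitary (H →L[ℂ] H)} {S : GrassmannComponent S₀}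
    (h : S ∈ (chart u).source) (x : Taut S) :
    (x : H) = (u : H →L[ℂ] H) (graphMap S₀ (chart u S) (fiberMap u S x)) := by
  have h1 : graphMap S₀ (chart u S) (fiberMap u S x)
      = ((u⁻¹ : unitary (H →L[ℂ] H)) : H →L[ℂ] H) (x : H) :=
    graphMap_graphCoord h (unitaryEquiv u⁻¹ S.space x)
  rw [h1]
  change (x : H) = ((u * u⁻¹ : unitary (H →L[ℂ] H)) : H →L[ℂ] H) x
  simp

/-- The map `(S, x) ↦ x` from the tautological bundle to the ambient Hilbert space. -/
def inclusion (ξ : TotalSpace S₀ (Taut (S₀ := S₀))) : H := ξ.snd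

/-- The differential of `(S, x) ↦ x` in the preferred chart at a point over `S = u S₀`, in which
this map reads `(T, y) ↦ u (y + T y)` and the base point has `T = 0`. -/
def inclusionDeriv (u : unitary (H →L[ℂ] H)) (y : S₀) : (S₀ →L[ℂ] S₀ᗮ) × S₀ →L[ℝ] H :=
  graphDeriv ((u : H →L[ℂ] H) ∘L S₀.subtypeL) ((u : H →L[ℂ] H) ∘L S₀ᗮ.subtypeL) y

theorem hasMFDerivAt_inclusion (ξ : TotalSpace S₀ (Taut (S₀ := S₀))) :
    HasMFDerivAt (𝓘(ℝ, S₀ →L[ℂ] S₀ᗮ).prod 𝓘(ℝ, S₀)) 𝓘(ℝ, H) inclusion ξ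
      (inclusionDeriv ξ.proj.exists_unitary.choose
        (fiberMap ξ.proj.exists_unitary.choose ξ.proj ξ.snd)) := by
  set u := ξ.proj.exists_unitary.choose with hu
  have h0 : chart u ξ.proj = 0 := chart_eq_zero ξ.proj.exists_unitary.choose_spec
  have h1 := (hasMFDerivAt_chartAt_self (EB := S₀ →L[ℂ] S₀ᗮ) ξ.proj).comp ξ (hasMFDerivAt_proj ξ)
  have h2 := hasMFDerivAt_trivializationAt_snd (EB := S₀ →L[ℂ] S₀ᗮ) ξ
  have h3 := hasMFDerivAt_graph ((u : H →L[ℂ] H) ∘L S₀.subtypeL)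
    ((u : H →L[ℂ] H) ∘L S₀ᗮ.subtypeL) h1 h2 h0
  have hev : ∀ᶠ η : TotalSpace S₀ (Taut (S₀ := S₀)) in 𝓝 ξ, η.proj ∈ (chart u).source :=
    (FiberBundle.continuous_proj S₀ (Taut (S₀ := S₀))).continuousAt.eventually_mem
      ((chartHomeo u).open_source.mem_nhds (mem_chart_source_choose ξ.proj))
  refine h3.congr_of_eventuallyEq ?_
  filter_upwards [hev] with η hη
  exact (coe_eq_graphMap hη η.snd).trans (map_add (u : H →L[ℂ] H) _ _)

variable (S₀) in
/-- The operator `p_{S₀} u⁻¹`. -/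
def projInv (u : unitary (H →L[ℂ] H)) : H →L[ℂ] S₀ :=
  S₀.orthogonalProjectionOnto ∘L ((u⁻¹ : unitary (H →L[ℂ] H)) : H →L[ℂ] H)

variable (S₀) in
/-- The operator `p_{S₀ᗮ} u⁻¹`. -/
def projOrthInv (u : unitary (H →L[ℂ] H)) : H →L[ℂ] S₀ᗮ :=
  S₀ᗮ.orthogonalProjectionOnto ∘L ((u⁻¹ : unitary (H →L[ℂ] H)) : H →L[ℂ] H)

/-- If `A` parametrizes `S` by `S₀`, then `S` lies in the domain of the chart given by `u` if and
only if the component of `u⁻¹ A` in `S₀` is invertible. -/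
theorem mem_chart_source_iff (u : unitary (H →L[ℂ] H)) {S : GrassmannComponent S₀}
    {A : S₀ →L[ℂ] H} (e : S₀ ≃L[ℂ] S.space) (he : S.space.subtypeL ∘L (e : S₀ →L[ℂ] S.space) = A) :
    S ∈ (chart u).source ↔ (projInv S₀ u ∘L A).IsInvertible :=
  isGraphOver_iff (S := (act u⁻¹ S).space) (A := ((u⁻¹ : unitary (H →L[ℂ] H)) : H →L[ℂ] H) ∘L A)
    (e.trans (unitaryEquiv u⁻¹ S.space)) (by rw [← he]; rfl)

/-- If `A` parametrizes `S` by `S₀`, then the chart given by `u` maps `S` to the slope of the graph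
`{u⁻¹ A x}`, the component of `u⁻¹ A` in `S₀ᗮ` composed with the inverse of that in `S₀`. -/
theorem chart_eq_of_param (u : unitary (H →L[ℂ] H)) {S : GrassmannComponent S₀}
    {A : S₀ →L[ℂ] H} (e : S₀ ≃L[ℂ] S.space) (he : S.space.subtypeL ∘L (e : S₀ →L[ℂ] S.space) = A) :
    chart u S = (projOrthInv S₀ u ∘L A) ∘L (projInv S₀ u ∘L A).inverse :=
  graphCoord_eq (S := (act u⁻¹ S).space) (A := ((u⁻¹ : unitary (H →L[ℂ] H)) : H →L[ℂ] H) ∘L A)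
    (e.trans (unitaryEquiv u⁻¹ S.space)) (by rw [← he]; rfl)

variable {EM : Type*} [NormedAddCommGroup EM] [NormedSpace ℝ EM] {HM : Type*} [TopologicalSpace HM]
  {IM : ModelWithCorners ℝ EM HM} {M : Type*} [TopologicalSpace M] [ChartedSpace HM M]

/-- A map to `Gr_{S₀}(H)` is differentiable if its values are parametrized by `S₀` through a
differentiable family of operators `S₀ → H`. -/
theorem hasMFDerivAt_of_param {f : M → GrassmannComponent S₀} {A : M → S₀ →L[ℂ] H} {m : M}
    {A' : TangentSpace IM m →L[ℝ] (S₀ →L[ℂ] H)} (hA : HasMFDerivAt IM 𝓘(ℝ, S₀ →L[ℂ] H) A m A')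
    (he : ∀ᶠ x in 𝓝 m, ∃ e : S₀ ≃L[ℂ] (f x).space,
      (f x).space.subtypeL ∘L (e : S₀ →L[ℂ] (f x).space) = A x) :
    HasMFDerivAt IM 𝓘(ℝ, S₀ →L[ℂ] S₀ᗮ) f m
      (slopeDeriv (projInv S₀ (f m).exists_unitary.choose)
        (projOrthInv S₀ (f m).exists_unitary.choose) (A m) ∘L A') := by
  set u := (f m).exists_unitary.choose with hu
  obtain ⟨e₀, he₀⟩ := he.self_of_nhds
  have hmem : f m ∈ (chart u).source := mem_chart_source_choose (f m)
  have hinv := (mem_chart_source_iff u e₀ he₀).1 hmem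
  have hA0 : projOrthInv S₀ u ∘L A m = 0 := by
    ext1 x
    have h1 : ((u⁻¹ : unitary (H →L[ℂ] H)) : H →L[ℂ] H) (A m x) ∈ (act u⁻¹ (f m)).space := by
      rw [← he₀]
      exact ⟨e₀ x, (e₀ x).2, rfl⟩
    rw [act_inv_eq_base (f m).exists_unitary.choose_spec] at h1
    have hx : S₀ᗮ.orthogonalProjectionOnto (((u⁻¹ : unitary (H →L[ℂ] H)) : H →L[ℂ] H) (A m x)) = 0 :=
      orthogonalProjectionOnto_orthogonal_of_mem h1
    rw [ContinuousLinearMap.comp_apply, zero_apply]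
    exact hx
  have hG := hasMFDerivAt_slope (projInv S₀ u) (projOrthInv S₀ u) hA hinv hA0
  have hopen : IsOpen (range ((↑) : (S₀ ≃L[ℂ] S₀) → S₀ →L[ℂ] S₀)) := ContinuousLinearEquiv.isOpen
  have hcont : ContinuousAt (fun x ↦ projInv S₀ u ∘L A x) m :=
    continuousAt_const.clm_comp hA.continuousAt
  have hev : ∀ᶠ x in 𝓝 m, f x ∈ (chart u).source := by
    filter_upwards [he, hcont.eventually_mem (hopen.mem_nhds hinv)] with x ⟨e, hx⟩ hx'
    exact (mem_chart_source_iff u e hx).2 hx'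
  have heq : (chartHomeo u ∘ f) =ᶠ[𝓝 m]
      fun x ↦ (projOrthInv S₀ u ∘L A x) ∘L (projInv S₀ u ∘L A x).inverse := by
    filter_upwards [he] with x ⟨e, hx⟩
    exact chart_eq_of_param u e hx
  have hG' := hG.congr_of_eventuallyEq heq
  exact ⟨((chartHomeo u).continuousAt_iff_continuousAt_comp_left hev).2 hG'.continuousAt, hG'.2⟩

end GrassmannComponent

end Tautological

/-! ### Velocities of the paths `[(u exp(tX), x + t y)]` -/

section Velocities

variable {H : Type*} [NormedAddCommGroup H] [InnerProductSpace ℂ H] [CompleteSpace H]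
  {S₀ : Submodule ℂ H} [CompleteSpace S₀]

open GrassmannComponent

theorem unitary_inv_apply_self (u : unitary (H →L[ℂ] H)) (x : H) :
    ((u⁻¹ : unitary (H →L[ℂ] H)) : H →L[ℂ] H) ((u : H →L[ℂ] H) x) = x := by
  change ((u⁻¹ * u : unitary (H →L[ℂ] H)) : H →L[ℂ] H) x = x
  rw [inv_mul_cancel]
  rfl

theorem inner_unitary_apply (u : unitary (H →L[ℂ] H)) (x y : H) :
    ⟪(u : H →L[ℂ] H) x, (u : H →L[ℂ] H) y⟫_ℂ = ⟪x, y⟫_ℂ := by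
  rw [← ContinuousLinearMap.adjoint_inner_right]
  exact congrArg (fun z ↦ ⟪x, z⟫_ℂ) (unitary_inv_apply_self u y)

namespace GrassmannComponent

theorem totalSpace_ext {ξ η : TotalSpace S₀ (Taut (S₀ := S₀))} (h : ξ.proj = η.proj)
    (h' : inclusion ξ = inclusion η) : ξ = η := by
  obtain ⟨S, x⟩ := ξ
  obtain ⟨S', x'⟩ := η
  obtain rfl : S = S' := h
  exact congrArg (TotalSpace.mk S) (Subtype.ext h')

theorem unitary_fiberMap {S : GrassmannComponent S₀} (x : Taut S) :
    (S.exists_unitary.choose : H →L[ℂ] H) (fiberMap S.exists_unitary.choose S x : S₀) = (x : H) := by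
  have h := coe_eq_graphMap (mem_chart_source_choose S) x
  rw [chart_eq_zero S.exists_unitary.choose_spec] at h
  rw [h]
  simp [graphMap]

/-- A tangent vector to the tautological bundle is determined by its base point, its base
component, and its image under the differential of `(S, x) ↦ x`. -/
theorem tangentBundle_ext
    {w w' : TangentBundle (𝓘(ℝ, S₀ →L[ℂ] S₀ᗮ).prod 𝓘(ℝ, S₀)) (TotalSpace S₀ (Taut (S₀ := S₀)))}
    (h : w.proj = w'.proj)
    (h1 : mfderiv (𝓘(ℝ, S₀ →L[ℂ] S₀ᗮ).prod 𝓘(ℝ, S₀)) 𝓘(ℝ, S₀ →L[ℂ] S₀ᗮ)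
        (TotalSpace.proj : TotalSpace S₀ (Taut (S₀ := S₀)) → _) w.proj w.snd
      = mfderiv (𝓘(ℝ, S₀ →L[ℂ] S₀ᗮ).prod 𝓘(ℝ, S₀)) 𝓘(ℝ, S₀ →L[ℂ] S₀ᗮ)
        (TotalSpace.proj : TotalSpace S₀ (Taut (S₀ := S₀)) → _) w'.proj w'.snd)
    (h2 : mfderiv (𝓘(ℝ, S₀ →L[ℂ] S₀ᗮ).prod 𝓘(ℝ, S₀)) 𝓘(ℝ, H) inclusion w.proj w.snd
      = mfderiv (𝓘(ℝ, S₀ →L[ℂ] S₀ᗮ).prod 𝓘(ℝ, S₀)) 𝓘(ℝ, H) inclusion w'.proj w'.snd) :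
    w = w' := by
  obtain ⟨ξ, a⟩ := w
  obtain ⟨ξ', a'⟩ := w'
  obtain rfl : ξ = ξ' := h
  simp only [(hasMFDerivAt_proj ξ).mfderiv, (hasMFDerivAt_inclusion ξ).mfderiv] at h1 h2
  have h3 : a.1 = a'.1 := h1
  set u := ξ.proj.exists_unitary.choose with hu
  replace h2 : (u : H →L[ℂ] H) (a.2 : S₀) + (u : H →L[ℂ] H) (a.1 (fiberMap u ξ.proj ξ.snd) : S₀ᗮ) =
      (u : H →L[ℂ] H) (a'.2 : S₀) + (u : H →L[ℂ] H) (a'.1 (fiberMap u ξ.proj ξ.snd) : S₀ᗮ) := h2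
  rw [h3, add_left_inj] at h2
  have h4 : a.2 = a'.2 := by
    apply Subtype.ext
    rw [← unitary_inv_apply_self u (a.2 : S₀), h2, unitary_inv_apply_self]
  exact congrArg (TotalSpace.mk ξ) (Prod.ext h3 h4)

end GrassmannComponent

theorem hasDerivAt_unitaryExp (u : unitary (H →L[ℂ] H)) (X : skewAdjoint (H →L[ℂ] H)) :
    HasDerivAt (fun t : ℝ ↦ ((u * unitaryExp (t • X) : unitary (H →L[ℂ] H)) : H →L[ℂ] H))
      ((u : H →L[ℂ] H) * X) 0 := by
  have h := (hasDerivAt_exp_smul_const (𝕂 := ℝ) (X : H →L[ℂ] H) 0).const_mul (u : H →L[ℂ] H)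
  rw [zero_smul, NormedSpace.exp_zero, one_mul] at h
  exact h

theorem unitaryExp_zero_smul (X : skewAdjoint (H →L[ℂ] H)) : unitaryExp ((0 : ℝ) • X) = 1 := by
  apply Subtype.ext
  change NormedSpace.exp ((0 : ℝ) • (X : H →L[ℂ] H)) = 1
  rw [zero_smul]
  exact NormedSpace.exp_zero

variable (S₀) in
/-- The path `t ↦ [(u exp(tX), x + t y)]` in the tautological bundle. -/
def homPath (q : unitary (H →L[ℂ] H) × skewAdjoint (H →L[ℂ] H) × S₀ × S₀) (t : ℝ) :
    TotalSpace S₀ (Taut (S₀ := S₀)) :=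
  homPoint S₀ (q.1 * unitaryExp (t • q.2.1)) (q.2.2.1 + t • q.2.2.2)

theorem homPath_zero (q : unitary (H →L[ℂ] H) × skewAdjoint (H →L[ℂ] H) × S₀ × S₀) :
    homPath S₀ q 0 = homPoint S₀ q.1 q.2.2.1 := by
  rw [homPath, unitaryExp_zero_smul, mul_one, zero_smul, add_zero]

theorem hasDerivAt_inclusion_homPath
    (q : unitary (H →L[ℂ] H) × skewAdjoint (H →L[ℂ] H) × S₀ × S₀) :
    HasDerivAt (fun t ↦ inclusion (homPath S₀ q t))
      ((q.1 : H →L[ℂ] H) ((q.2.1 : H →L[ℂ] H) q.2.2.1 + q.2.2.2)) 0 := by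
  have h1 : HasDerivAt (fun t : ℝ ↦ ((q.2.2.1 + t • q.2.2.2 : S₀) : H)) (q.2.2.2 : H) 0 :=
    hasDerivAt_const_add_smul (q.2.2.1 : H) (q.2.2.2 : H)
  have h2 : HasFDerivAt (fun p : (H →L[ℂ] H) × H ↦ p.1 p.2) _
    ((q.1 : H →L[ℂ] H), (q.2.2.1 : H)) := hasFDerivAt_fst.clm_apply (𝕜 := ℂ) hasFDerivAt_snd
  have h3 := HasFDerivAt.comp_hasDerivAt_of_eq (0 : ℝ) (h2.restrictScalars ℝ)
    ((hasDerivAt_unitaryExp q.1 q.2.1).prodMk h1)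
    (by rw [unitaryExp_zero_smul, mul_one, zero_smul, add_zero])
  refine HasDerivAt.congr_deriv h3 ?_
  rw [map_add, add_comm]
  rfl

/-- The path is differentiable, and the base component of its velocity is the derivative of the slope
of the graph parametrized by `u exp(tX)` on `S₀`. -/
theorem hasMFDerivAt_homPath
    (q : unitary (H →L[ℂ] H) × skewAdjoint (H →L[ℂ] H) × S₀ × S₀) :
    ∃ (b : ℝ →L[ℝ] (S₀ →L[ℂ] S₀ᗮ)) (c : ℝ →L[ℝ] S₀),
      HasMFDerivAt 𝓘(ℝ, ℝ) (𝓘(ℝ, S₀ →L[ℂ] S₀ᗮ).prod 𝓘(ℝ, S₀)) (homPath S₀ q) 0 (b.prod c) ∧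
      b 1 = (projOrthInv S₀ (homPath S₀ q 0).proj.exists_unitary.choose ∘L
          ((q.1 : H →L[ℂ] H) ∘L (q.2.1 : H →L[ℂ] H) ∘L S₀.subtypeL)) ∘L
        (projInv S₀ (homPath S₀ q 0).proj.exists_unitary.choose ∘L
          ((q.1 : H →L[ℂ] H) ∘L S₀.subtypeL)).inverse := by
  obtain ⟨A', hA', hA1⟩ := exists_hasMFDerivAt_comp_right
    (hasDerivAt_unitaryExp q.1 q.2.1) S₀.subtypeL
  have h2 := hasMFDerivAt_of_param (f := fun t ↦ (homPath S₀ q t).proj) hA'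
    (Eventually.of_forall fun t ↦ ⟨unitaryEquiv _ S₀, rfl⟩)
  obtain ⟨c, hc, -⟩ := exists_hasMFDerivAt
    (((projInv S₀ (homPath S₀ q 0).proj.exists_unitary.choose).restrictScalars
    ℝ).hasFDerivAt.comp_hasDerivAt (0 : ℝ) (hasDerivAt_inclusion_homPath q))
  refine ⟨_, c, hasMFDerivAt_totalSpace (f := homPath S₀ q) h2 hc, ?_⟩
  change slopeDeriv _ _ (((q.1 * unitaryExp ((0 : ℝ) • q.2.1) : unitary (H →L[ℂ] H)) : H →L[ℂ] H) ∘L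
    S₀.subtypeL) (A' 1) = _
  rw [hA1, slopeDeriv_apply, unitaryExp_zero_smul, mul_one]
  rfl

end Velocities

/-! ### The universal connection -/

section UniversalConnection

variable {H : Type*} [NormedAddCommGroup H] [InnerProductSpace ℂ H] [CompleteSpace H]
  {S₀ : Submodule ℂ H} [CompleteSpace S₀]

open GrassmannComponent

theorem homTangent_proj (q : unitary (H →L[ℂ] H) × skewAdjoint (H →L[ℂ] H) × S₀ × S₀) :
    (homTangent S₀ q).proj = homPoint S₀ q.1 q.2.2.1 := homPath_zero q

theorem mfderiv_proj_homTangent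
    (q : unitary (H →L[ℂ] H) × skewAdjoint (H →L[ℂ] H) × S₀ × S₀) :
    mfderiv (𝓘(ℝ, S₀ →L[ℂ] S₀ᗮ).prod 𝓘(ℝ, S₀)) 𝓘(ℝ, S₀ →L[ℂ] S₀ᗮ)
        (TotalSpace.proj : TotalSpace S₀ (Taut (S₀ := S₀)) → _) (homTangent S₀ q).proj
        (homTangent S₀ q).snd =
      (projOrthInv S₀ (homTangent S₀ q).proj.proj.exists_unitary.choose ∘L
          ((q.1 : H →L[ℂ] H) ∘L (q.2.1 : H →L[ℂ] H) ∘L S₀.subtypeL)) ∘L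
        (projInv S₀ (homTangent S₀ q).proj.proj.exists_unitary.choose ∘L
          ((q.1 : H →L[ℂ] H) ∘L S₀.subtypeL)).inverse := by
  obtain ⟨b, c, h, hb⟩ := hasMFDerivAt_homPath q
  rw [(hasMFDerivAt_proj _).mfderiv]
  refine Eq.trans ?_ hb
  change (mfderiv 𝓘(ℝ, ℝ) (𝓘(ℝ, S₀ →L[ℂ] S₀ᗮ).prod 𝓘(ℝ, S₀)) (homPath S₀ q) 0 (1 : ℝ)).1 = b 1
  rw [h.mfderiv]
  rfl

theorem mfderiv_inclusion_homTangent
    (q : unitary (H →L[ℂ] H) × skewAdjoint (H →L[ℂ] H) × S₀ × S₀) :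
    mfderiv (𝓘(ℝ, S₀ →L[ℂ] S₀ᗮ).prod 𝓘(ℝ, S₀)) 𝓘(ℝ, H) inclusion (homTangent S₀ q).proj
        (homTangent S₀ q).snd = (q.1 : H →L[ℂ] H) ((q.2.1 : H →L[ℂ] H) q.2.2.1 + q.2.2.2) := by
  obtain ⟨b, c, h, hb⟩ := hasMFDerivAt_homPath q
  have h1 := (hasMFDerivAt_inclusion (homPath S₀ q 0)).mdifferentiableAt.hasMFDerivAt.comp 0
    h.mdifferentiableAt.hasMFDerivAt
  have h2 := hasMFDerivAt_unique h1 (hasDerivAt_inclusion_homPath q).hasFDerivAt.hasMFDerivAt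
  have h3 := congrArg (fun L : ℝ →L[ℝ] H ↦ L 1) h2
  exact h3.trans (one_smul ℝ _)

/-- The skew-adjoint operator on `H = S₀ ⊕ S₀ᗮ` with off-diagonal entries `T` and `-T*`. -/
def offDiagonal (T : S₀ →L[ℂ] S₀ᗮ) : skewAdjoint (H →L[ℂ] H) :=
  ⟨S₀ᗮ.subtypeL ∘L T ∘L S₀.orthogonalProjectionOnto
      - star (S₀ᗮ.subtypeL ∘L T ∘L S₀.orthogonalProjectionOnto), by
    rw [skewAdjoint.mem_iff, star_sub, star_star, neg_sub]⟩

theorem offDiagonal_apply (T : S₀ →L[ℂ] S₀ᗮ) (x : S₀) :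
    (offDiagonal T : H →L[ℂ] H) x = T x := by
  have h : star (S₀ᗮ.subtypeL ∘L T ∘L S₀.orthogonalProjectionOnto : H →L[ℂ] H) (x : H) = 0 := by
    refine ext_inner_right ℂ fun z ↦ ?_
    rw [ContinuousLinearMap.star_eq_adjoint, ContinuousLinearMap.adjoint_inner_left, inner_zero_left]
    exact (T _).2 x x.2
  change (T (S₀.orthogonalProjectionOnto x) : H) -
    (star (S₀ᗮ.subtypeL ∘L T ∘L S₀.orthogonalProjectionOnto) : H →L[ℂ] H) (x : H) = T x
  rw [h, sub_zero, Submodule.orthogonalProjectionOnto_mem_subspace_eq_self]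

theorem projInv_comp (u : unitary (H →L[ℂ] H)) :
    projInv S₀ u ∘L (u : H →L[ℂ] H) ∘L S₀.subtypeL = ContinuousLinearMap.id ℂ S₀ := by
  ext1 x
  change S₀.orthogonalProjectionOnto (((u⁻¹ : unitary (H →L[ℂ] H)) : H →L[ℂ] H)
    ((u : H →L[ℂ] H) x)) = x
  rw [unitary_inv_apply_self, Submodule.orthogonalProjectionOnto_mem_subspace_eq_self]

/-- Every tangent vector to the tautological bundle is the velocity of a path
`t ↦ [(u exp(tX), x + t y)]`. -/
theorem homTangent_surjective : Function.Surjective (homTangent S₀) := by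
  rintro ⟨ξ, a⟩
  set u := ξ.proj.exists_unitary.choose with hu
  set x := fiberMap u ξ.proj ξ.snd with hx
  have hux : (u : H →L[ℂ] H) x = inclusion ξ := unitary_fiberMap ξ.snd
  have hpt : (homTangent S₀ (u, offDiagonal a.1, x, a.2)).proj = ξ := by
    rw [homTangent_proj]
    refine totalSpace_ext ?_ hux
    exact GrassmannComponent.ext ξ.proj.exists_unitary.choose_spec.symm
  refine ⟨(u, offDiagonal a.1, x, a.2), tangentBundle_ext hpt ?_ ?_⟩
  · rw [mfderiv_proj_homTangent, hpt, (hasMFDerivAt_proj _).mfderiv]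
    change (projOrthInv S₀ u ∘L ((u : H →L[ℂ] H) ∘L (offDiagonal a.1 : H →L[ℂ] H) ∘L S₀.subtypeL)) ∘L
        (projInv S₀ u ∘L ((u : H →L[ℂ] H) ∘L S₀.subtypeL)).inverse = a.1
    rw [projInv_comp, ContinuousLinearMap.inverse_id]
    ext1 z
    change S₀ᗮ.orthogonalProjectionOnto (((u⁻¹ : unitary (H →L[ℂ] H)) : H →L[ℂ] H)
      ((u : H →L[ℂ] H) ((offDiagonal a.1 : H →L[ℂ] H) z))) = a.1 z
    rw [unitary_inv_apply_self, offDiagonal_apply,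
      Submodule.orthogonalProjectionOnto_mem_subspace_eq_self]
  · rw [mfderiv_inclusion_homTangent, (hasMFDerivAt_inclusion _).mfderiv]
    change (u : H →L[ℂ] H) ((offDiagonal a.1 : H →L[ℂ] H) x + a.2) =
      (u : H →L[ℂ] H) (a.2 : S₀) + (u : H →L[ℂ] H) (a.1 x : S₀ᗮ)
    rw [offDiagonal_apply, map_add, add_comm]

/-- On `S₀` the operator `E_p(X)` is `p X`. -/
theorem condExpectation_apply (X : skewAdjoint (H →L[ℂ] H)) (x : S₀) :
    (condExpectation S₀ X : H →L[ℂ] H) x = S₀.starProjection ((X : H →L[ℂ] H) x) := by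
  change S₀.starProjection ((X : H →L[ℂ] H) (S₀.starProjection x)) +
    (1 - S₀.starProjection : H →L[ℂ] H) ((X : H →L[ℂ] H)
      ((x : H) - S₀.starProjection x)) = _
  rw [Submodule.starProjection_eq_self_iff.2 x.2, sub_self, map_zero, map_zero, add_zero]

theorem universalConnection_proj
    (w : TangentBundle (𝓘(ℝ, S₀ →L[ℂ] S₀ᗮ).prod 𝓘(ℝ, S₀)) (TotalSpace S₀ (Taut (S₀ := S₀)))) :
    (universalConnection S₀ w).proj = w.proj := by
  conv_rhs => rw [← Function.invFun_eq (homTangent_surjective w)]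
  rw [universalConnection, homTangent_proj, homTangent_proj]

/-- The values of the universal connection are vertical. -/
theorem mfderiv_proj_universalConnection
    (w : TangentBundle (𝓘(ℝ, S₀ →L[ℂ] S₀ᗮ).prod 𝓘(ℝ, S₀)) (TotalSpace S₀ (Taut (S₀ := S₀)))) :
    mfderiv (𝓘(ℝ, S₀ →L[ℂ] S₀ᗮ).prod 𝓘(ℝ, S₀)) 𝓘(ℝ, S₀ →L[ℂ] S₀ᗮ)
        (TotalSpace.proj : TotalSpace S₀ (Taut (S₀ := S₀)) → _) (universalConnection S₀ w).proj
        (universalConnection S₀ w).snd = 0 := by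
  rw [universalConnection, mfderiv_proj_homTangent]
  generalize Function.invFun (homTangent S₀) w = q
  set r := (q.1, condExpectation S₀ q.2.1, q.2.2) with hr
  have hspace : (homTangent S₀ r).proj.proj.space = unitaryMap q.1 S₀ := by
    rw [homTangent_proj]
    rfl
  set S := (homTangent S₀ r).proj.proj with hS
  have h0 : projOrthInv S₀ S.exists_unitary.choose ∘L
      ((q.1 : H →L[ℂ] H) ∘L (condExpectation S₀ q.2.1 : H →L[ℂ] H) ∘L S₀.subtypeL) = 0 := by
    ext1 x
    have h1 : (q.1 : H →L[ℂ] H) ((condExpectation S₀ q.2.1 : H →L[ℂ] H) x) ∈ S.space := by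
      rw [hspace, condExpectation_apply]
      exact ⟨_, Submodule.starProjection_apply_mem _ _, rfl⟩
    rw [S.exists_unitary.choose_spec] at h1
    obtain ⟨y, hy, hy'⟩ := h1
    change (S.exists_unitary.choose : H →L[ℂ] H) y = _ at hy'
    change S₀ᗮ.orthogonalProjectionOnto (((S.exists_unitary.choose⁻¹ : unitary (H →L[ℂ] H)) :
      H →L[ℂ] H) ((q.1 : H →L[ℂ] H) ((condExpectation S₀ q.2.1 : H →L[ℂ] H) x))) = 0
    rw [← hy', unitary_inv_apply_self]
    exact orthogonalProjectionOnto_orthogonal_of_mem hy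
  change (projOrthInv S₀ S.exists_unitary.choose ∘L
      ((q.1 : H →L[ℂ] H) ∘L (condExpectation S₀ q.2.1 : H →L[ℂ] H) ∘L S₀.subtypeL)) ∘L _ = 0
  rw [h0, ContinuousLinearMap.zero_comp]

/-- Under the differential of `(S, x) ↦ x`, the universal connection becomes the orthogonal
projection onto `S`. -/
theorem mfderiv_inclusion_universalConnection
    (w : TangentBundle (𝓘(ℝ, S₀ →L[ℂ] S₀ᗮ).prod 𝓘(ℝ, S₀)) (TotalSpace S₀ (Taut (S₀ := S₀))))
    [w.proj.proj.space.HasOrthogonalProjection] :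
    mfderiv (𝓘(ℝ, S₀ →L[ℂ] S₀ᗮ).prod 𝓘(ℝ, S₀)) 𝓘(ℝ, H) inclusion (universalConnection S₀ w).proj
        (universalConnection S₀ w).snd =
      w.proj.proj.space.starProjection
        (mfderiv (𝓘(ℝ, S₀ →L[ℂ] S₀ᗮ).prod 𝓘(ℝ, S₀)) 𝓘(ℝ, H) inclusion w.proj w.snd : H) := by
  obtain ⟨q, hq⟩ : ∃ q, q = Function.invFun (homTangent S₀) w := ⟨_, rfl⟩
  have hw : homTangent S₀ q = w := hq ▸ Function.invFun_eq (homTangent_surjective w)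
  have hspace : w.proj.proj.space = unitaryMap q.1 S₀ := by
    rw [← hw, homTangent_proj]
    rfl
  have h1 : (mfderiv (𝓘(ℝ, S₀ →L[ℂ] S₀ᗮ).prod 𝓘(ℝ, S₀)) 𝓘(ℝ, H) inclusion w.proj w.snd : H) =
      (q.1 : H →L[ℂ] H) ((q.2.1 : H →L[ℂ] H) q.2.2.1 + q.2.2.2) := by
    rw [← mfderiv_inclusion_homTangent, hw]
  rw [universalConnection, ← hq, mfderiv_inclusion_homTangent, h1, condExpectation_apply]
  refine Eq.symm (α := H) ?_
  refine Submodule.eq_starProjection_of_mem_of_inner_eq_zero ?_ ?_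
  · rw [hspace]
    exact ⟨_, add_mem (Submodule.starProjection_apply_mem _ _) q.2.2.2.2, rfl⟩
  · intro z hz
    rw [hspace] at hz
    obtain ⟨y, hy, rfl⟩ := hz
    change ⟪_, (q.1 : H →L[ℂ] H) y⟫_ℂ = 0
    rw [← map_sub, inner_unitary_apply, add_sub_add_right_eq_sub]
    exact Submodule.starProjection_inner_eq_zero _ y hy

end UniversalConnection

/-! ### Vertical vectors -/

section Vertical

variable {EZ : Type*} [NormedAddCommGroup EZ] [NormedSpace ℝ EZ]
  {Z : Type*} [TopologicalSpace Z] [ChartedSpace EZ Z]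
  {F : Type*} [NormedAddCommGroup F] [InnerProductSpace ℂ F]
  {D : Z → Type*} [TopologicalSpace (TotalSpace F D)]
  [∀ z, NormedAddCommGroup (D z)] [∀ z, InnerProductSpace ℂ (D z)] [FiberBundle F D]

theorem tangentBundle_ext_of_snd_eq {E E' : Type*} [NormedAddCommGroup E] [NormedSpace ℝ E]
    [TopologicalSpace E'] {I : ModelWithCorners ℝ E E'} {M : Type*} [TopologicalSpace M]
    [ChartedSpace E' M] {w w' : TangentBundle I M} (h : w.proj = w'.proj)
    (h' : (w.snd : E) = w'.snd) : w = w' := by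
  obtain ⟨x, a⟩ := w
  obtain ⟨x', a'⟩ := w'
  obtain rfl : x = x' := h
  exact congrArg (TotalSpace.mk x) h'

theorem verticalLift_proj (p : Σ z, D z × D z) : (verticalLift EZ F D p).proj = ⟨p.1, p.2.1⟩ := by
  change (⟨p.1, p.2.1 + (0 : ℝ) • p.2.2⟩ : TotalSpace F D) = _
  rw [zero_smul, add_zero]

variable [VectorBundle ℂ F D]

variable (F D) in
/-- The preferred trivialization restricted to the fiber over `z`. -/
def fiberCoord (z : Z) : D z ≃L[ℂ] F :=
  (trivializationAt F D z).continuousLinearEquivAt ℂ z (mem_baseSet_trivializationAt F D z)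

theorem hasMFDerivAt_verticalPath (p : Σ z, D z × D z) :
    HasMFDerivAt 𝓘(ℝ, ℝ) (𝓘(ℝ, EZ).prod 𝓘(ℝ, F))
      (fun t : ℝ ↦ (⟨p.1, p.2.1 + t • p.2.2⟩ : TotalSpace F D)) 0
      ((0 : ℝ →L[ℝ] EZ).prod (ContinuousLinearMap.toSpanSingleton ℝ (fiberCoord F D p.1 p.2.2))) := by
  have h1 := hasDerivAt_const_add_smul p.2.1 p.2.2
  have h2 := ((fiberCoord F D p.1 : D p.1 →L[ℂ] F).restrictScalars ℝ).hasFDerivAt.comp_hasDerivAt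
    (0 : ℝ) h1
  exact hasMFDerivAt_totalSpace
    (f := fun t : ℝ ↦ (⟨p.1, p.2.1 + t • p.2.2⟩ : TotalSpace F D))
    (hasMFDerivAt_const p.1 (0 : ℝ)) h2.hasFDerivAt.hasMFDerivAt

theorem verticalLift_snd (p : Σ z, D z × D z) :
    ((verticalLift EZ F D p).snd : EZ × F) = (0, fiberCoord F D p.1 p.2.2) := by
  change mfderiv 𝓘(ℝ, ℝ) (𝓘(ℝ, EZ).prod 𝓘(ℝ, F))
      (fun t : ℝ ↦ (⟨p.1, p.2.1 + t • p.2.2⟩ : TotalSpace F D)) 0 (1 : ℝ) = _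
  rw [(hasMFDerivAt_verticalPath p).mfderiv]
  exact Prod.ext rfl (one_smul ℝ _)

theorem verticalLift_injective : Function.Injective (verticalLift EZ F D) := by
  rintro ⟨z, a, b⟩ ⟨z', a', b'⟩ h
  have h1 := congrArg TotalSpace.proj h
  rw [verticalLift_proj, verticalLift_proj] at h1
  obtain rfl : z = z' := congrArg TotalSpace.proj h1
  obtain rfl : a = a' := eq_of_heq (TotalSpace.mk.inj h1).2
  have h2 : ((verticalLift EZ F D ⟨z, a, b⟩).snd : EZ × F) =
    ((verticalLift EZ F D ⟨z, a, b'⟩).snd : EZ × F) := by rw [h]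
  rw [verticalLift_snd, verticalLift_snd] at h2
  have h3 : fiberCoord F D z b = fiberCoord F D z b' := (Prod.mk.inj h2).2
  rw [(fiberCoord F D z).injective h3]

/-- Every vector in the kernel of the differential of the bundle projection is a vertical lift. -/
theorem exists_verticalLift_eq {w : TangentBundle (𝓘(ℝ, EZ).prod 𝓘(ℝ, F)) (TotalSpace F D)}
    (hw : (tangentMap (𝓘(ℝ, EZ).prod 𝓘(ℝ, F)) 𝓘(ℝ, EZ) TotalSpace.proj w).snd = 0) :
    ∃ b, verticalLift EZ F D ⟨w.proj.proj, w.proj.snd, b⟩ = w := by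
  obtain ⟨ξ, a⟩ := w
  have h0 : a.1 = 0 := by
    change mfderiv (𝓘(ℝ, EZ).prod 𝓘(ℝ, F)) 𝓘(ℝ, EZ) TotalSpace.proj ξ a = 0 at hw
    rwa [(hasMFDerivAt_proj ξ).mfderiv] at hw
  refine ⟨(fiberCoord F D ξ.proj).symm a.2, tangentBundle_ext_of_snd_eq (verticalLift_proj _) ?_⟩
  rw [verticalLift_snd]
  exact Prod.ext h0.symm ((fiberCoord F D ξ.proj).apply_symm_apply a.2)

theorem tangentMap_proj_verticalLift (p : Σ z, D z × D z) :
    (tangentMap (𝓘(ℝ, EZ).prod 𝓘(ℝ, F)) 𝓘(ℝ, EZ) TotalSpace.proj (verticalLift EZ F D p)).snd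
      = 0 := by
  change mfderiv (𝓘(ℝ, EZ).prod 𝓘(ℝ, F)) 𝓘(ℝ, EZ) TotalSpace.proj (verticalLift EZ F D p).proj
    (verticalLift EZ F D p).snd = 0
  rw [(hasMFDerivAt_proj (EB := EZ) _).mfderiv]
  have h := verticalLift_snd (EZ := EZ) (F := F) p
  exact congrArg (Prod.fst : EZ × F → EZ) h

theorem verticalProj_verticalLift (p : Σ z, D z × D z) :
    verticalProj (verticalLift EZ F D p) = ⟨p.1, p.2.2⟩ := by
  have : Nonempty (Σ z, D z × D z) := ⟨p⟩
  have h := Function.leftInverse_invFun (verticalLift_injective (EZ := EZ) (F := F) (D := D)) p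
  unfold verticalProj
  rw [h]

end Vertical

/-! ### The feature map and the classifying map -/

section Kernel
namespace ReproducingKernel

open GrassmannComponent

variable {EZ : Type*} [NormedAddCommGroup EZ] [NormedSpace ℝ EZ]
  {Z : Type*} [TopologicalSpace Z] [ChartedSpace EZ Z]
  {F : Type*} [NormedAddCommGroup F] [InnerProductSpace ℂ F]
  {D : Z → Type*} [TopologicalSpace (TotalSpace F D)]
  [∀ z, NormedAddCommGroup (D z)] [∀ z, InnerProductSpace ℂ (D z)] [∀ z, CompleteSpace (D z)]
  [FiberBundle F D] [VectorBundle ℂ F D] (K : ReproducingKernel F D)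

theorem eval_feature (t : Z) (ξ : TotalSpace F D) :
    K.eval t (K.feature ξ) = K t ξ.proj ξ.snd := K.eval_ofPre t _

theorem fiberFeature_injective {s : Z} (h : (K s s).IsInvertible) :
    Function.Injective (K.fiberFeature s) := by
  intro x y hxy
  have h1 := congrArg (K.eval s) hxy
  rw [fiberFeature_apply, fiberFeature_apply, eval_feature, eval_feature] at h1
  exact h.injective h1

/-- The reproducing property in the form `K̂_s K(s, s)⁻¹ K̂_s* = p_{ζ_K(s)}`. -/
theorem fiberFeature_inverse_eval {s : Z} (h : (K s s).IsInvertible) (f : K.Space) :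
    K.fiberFeature s ((K s s).inverse (K.eval s f)) = (K.classifyingSubspace s).starProjection f := by
  symm
  refine Submodule.eq_starProjection_of_mem_orthogonal
    (subset_closure (LinearMap.mem_range_self (K.fiberFeature s).toLinearMap _)) ?_
  rw [classifyingSubspace, Submodule.orthogonal_closure]
  rintro _ ⟨η, rfl⟩
  change ⟪K.fiberFeature s η, _⟫_ℂ = 0
  rw [← ContinuousLinearMap.adjoint_inner_right]
  change ⟪η, K.eval s _⟫_ℂ = 0
  rw [map_sub, fiberFeature_apply, eval_feature]
  change ⟪η, _ - K s s ((K s s).inverse _)⟫_ℂ = 0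
  rw [h.self_apply_inverse, sub_self, inner_zero_right]

/-- The map `ζ_K` into `Gr_{S₀}(H^K)` is differentiable. -/
theorem mdifferentiableAt_classifyingBase (hK : IsSmoothIntoGrassmannian EZ K.classifyingSubspace)
    (S₀ : Submodule ℂ K.Space) [CompleteSpace S₀]
    (hS₀ : ∀ s, ∃ u : unitary (K.Space →L[ℂ] K.Space), K.classifyingSubspace s = unitaryMap u S₀)
    (s : Z) :
    MDifferentiableAt 𝓘(ℝ, EZ) 𝓘(ℝ, S₀ →L[ℂ] S₀ᗮ) (K.classifyingBase S₀ hS₀) s := by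
  -- Near `s` the subspace `ζ_K(t)` is the graph of an operator on `ζ_K(s)` depending smoothly on
  -- `t`, which gives a parametrization of `ζ_K(t)` by `ζ_K(s) ≅ S₀`.
  obtain ⟨hgraph, hsmooth⟩ := hK s
  obtain ⟨e⟩ : Nonempty (S₀ ≃L[ℂ] K.classifyingSubspace s) := by
    obtain ⟨u, hu⟩ := hS₀ s
    rw [hu]
    exact ⟨unitaryEquiv u S₀⟩
  have hA := mdifferentiableAt_affine_comp (K.classifyingSubspace s).subtypeL
    (K.classifyingSubspace s)ᗮ.subtypeL (e : S₀ →L[ℂ] K.classifyingSubspace s)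
    (hsmooth.mdifferentiableAt (by simp))
  refine (hasMFDerivAt_of_param hA.hasMFDerivAt ?_).mdifferentiableAt
  filter_upwards [hgraph] with t ht
  obtain ⟨e', he'⟩ := ht
  refine ⟨e.trans e'.symm, ?_⟩
  ext y
  have h := graphMap_graphCoord (S₀ := K.classifyingSubspace s) ⟨e', he'⟩ (e'.symm (e y))
  have h2 : (K.classifyingSubspace s).orthogonalProjectionOnto (e'.symm (e y) : K.Space) = e y := by
    have := congrArg (fun L : K.classifyingSubspace t →L[ℂ] K.classifyingSubspace s ↦
      L (e'.symm (e y))) he'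
    exact this.symm.trans (e'.apply_symm_apply (e y))
  rw [h2] at h
  exact h.symm


/-- For a smooth kernel, `ξ ↦ K(s, Π(ξ)) ξ ∈ D_s` is differentiable at the points of `D_s`. -/
theorem mdifferentiableAt_eval_feature (hK : K.IsAdmissible EZ) (ξ : TotalSpace F D) :
    MDifferentiableAt (𝓘(ℝ, EZ).prod 𝓘(ℝ, F)) 𝓘(ℝ, D ξ.proj)
      (fun η ↦ K.eval ξ.proj (K.feature η)) ξ := by
  set s := ξ.proj with hs
  have h1 : MDifferentiableAt 𝓘(ℝ, EZ) 𝓘(ℝ, F →L[ℂ] F)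
      (fun z ↦ ContinuousLinearMap.inCoordinates F D F D s z s s (K s z)) s :=
    ((hK.contMDiff s s).mdifferentiableAt (by simp)).comp s
      (mdifferentiableAt_const.prodMk mdifferentiableAt_id)
  have h2 : MDifferentiableAt (𝓘(ℝ, EZ).prod 𝓘(ℝ, F)) 𝓘(ℝ, F →L[ℂ] F)
      (fun η : TotalSpace F D ↦ ContinuousLinearMap.inCoordinates F D F D s η.proj s s
        (K s η.proj)) ξ :=
    MDifferentiableAt.comp ξ (g := fun z ↦ ContinuousLinearMap.inCoordinates F D F D s z s s (K s z))
      h1 (hasMFDerivAt_proj ξ).mdifferentiableAt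
  have h3 := mdifferentiableAt_clm_apply h2
    (hasMFDerivAt_trivializationAt_snd (EB := EZ) ξ).mdifferentiableAt
  have h4 := (((fiberCoord F D s).symm : F →L[ℂ] D s).restrictScalars
    ℝ).differentiableAt.mdifferentiableAt.comp ξ h3
  refine h4.congr_of_eventuallyEq ?_
  have hev : ∀ᶠ η : TotalSpace F D in 𝓝 ξ, η.proj ∈ (trivializationAt F D s).baseSet :=
    (FiberBundle.continuous_proj F D).continuousAt.eventually_mem
      ((trivializationAt F D s).open_baseSet.mem_nhds (mem_baseSet_trivializationAt F D s))
  filter_upwards [hev] with η hη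
  rw [eval_feature]
  symm
  change (fiberCoord F D s).symm (ContinuousLinearMap.inCoordinates F D F D s η.proj s s
        (K s η.proj) (trivializationAt F D s η).2) = _
  rw [ContinuousLinearEquiv.symm_apply_eq, ContinuousLinearMap.inCoordinates_eq hη
    (mem_baseSet_trivializationAt F D s)]
  have h5 : ((trivializationAt F D s).continuousLinearEquivAt ℂ η.proj hη).symm
      ((trivializationAt F D s) η).2 = η.snd :=
    ((trivializationAt F D s).continuousLinearEquivAt ℂ η.proj hη).symm_apply_apply η.snd
  simp only [ContinuousLinearMap.comp_apply]
  exact congrArg (fun y ↦ fiberCoord F D s (K s η.proj y)) h5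

/-- The classifying map `δ_K` is differentiable: its fiber coordinate is
`p_{S₀} u⁻¹ K_η = p_{S₀} u⁻¹ K̂_s K(s, s)⁻¹ K(s, Π(η)) η` if `ζ_K(s) = u S₀`. -/
theorem mdifferentiableAt_classifyingMap (S₀ : Submodule ℂ K.Space) [CompleteSpace S₀]
    (hS₀ : ∀ s, ∃ u : unitary (K.Space →L[ℂ] K.Space), K.classifyingSubspace s = unitaryMap u S₀)
    (hK : K.IsAdmissible EZ) (ξ : TotalSpace F D) :
    MDifferentiableAt (𝓘(ℝ, EZ).prod 𝓘(ℝ, F)) (𝓘(ℝ, S₀ →L[ℂ] S₀ᗮ).prod 𝓘(ℝ, S₀))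
      (K.classifyingMap S₀ hS₀) ξ := by
  refine (mdifferentiableAt_totalSpace _ _).2 ⟨?_, ?_⟩
  · exact (K.mdifferentiableAt_classifyingBase hK.smooth_classifying S₀ hS₀ ξ.proj).comp ξ
      (hasMFDerivAt_proj ξ).mdifferentiableAt
  · set u := (K.classifyingBase S₀ hS₀ ξ.proj).exists_unitary.choose with hu
    have hspace : K.classifyingSubspace ξ.proj = unitaryMap u S₀ :=
      (K.classifyingBase S₀ hS₀ ξ.proj).exists_unitary.choose_spec
    have h := ((projInv S₀ u ∘L K.fiberFeature ξ.proj ∘L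
      (K ξ.proj ξ.proj).inverse).restrictScalars ℝ).differentiableAt.mdifferentiableAt.comp ξ
      (K.mdifferentiableAt_eval_feature hK ξ)
    refine h.congr_of_eventuallyEq (Eventually.of_forall fun η ↦ ?_)
    change projInv S₀ u (K.feature η) = projInv S₀ u (K.fiberFeature ξ.proj
      ((K ξ.proj ξ.proj).inverse (K.eval ξ.proj (K.feature η))))
    -- `p_{S₀} u⁻¹` vanishes on the orthogonal complement of `ζ_K(s) = u S₀`.
    rw [K.fiberFeature_inverse_eval (hK.isInvertible _), ← sub_eq_zero, ← map_sub]
    refine Submodule.orthogonalProjectionOnto_apply_of_mem_orthogonal fun x hx ↦ ?_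
    rw [← inner_unitary_apply u]
    have h1 : (u : K.Space →L[ℂ] K.Space) x ∈ K.classifyingSubspace ξ.proj := by
      rw [hspace]
      exact ⟨x, hx, rfl⟩
    have h2 := (K.classifyingSubspace ξ.proj).sub_starProjection_mem_orthogonal (K.feature η) _ h1
    have h3 : ∀ y, (u : K.Space →L[ℂ] K.Space)
        (((u⁻¹ : unitary (K.Space →L[ℂ] K.Space)) : K.Space →L[ℂ] K.Space) y) = y := fun y ↦ by
      have := unitary_inv_apply_self u⁻¹ y
      rwa [inv_inv] at this
    exact (congrArg (fun y ↦ ⟪(u : K.Space →L[ℂ] K.Space) x, y⟫_ℂ) (h3 _)).trans h2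

/-- The map `K̂ : D → H^K` is differentiable. -/
theorem mdifferentiableAt_feature (S₀ : Submodule ℂ K.Space) [CompleteSpace S₀]
    (hS₀ : ∀ s, ∃ u : unitary (K.Space →L[ℂ] K.Space), K.classifyingSubspace s = unitaryMap u S₀)
    (hK : K.IsAdmissible EZ) (ξ : TotalSpace F D) :
    MDifferentiableAt (𝓘(ℝ, EZ).prod 𝓘(ℝ, F)) 𝓘(ℝ, K.Space) K.feature ξ :=
  (hasMFDerivAt_inclusion _).mdifferentiableAt.comp ξ
    (K.mdifferentiableAt_classifyingMap S₀ hS₀ hK ξ)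

/-- The differential of `K̂` on vertical vectors is given by `K̂` itself, by linearity on fibers. -/
theorem mfderiv_feature_verticalLift {p : Σ z, D z × D z}
    (h : MDifferentiableAt (𝓘(ℝ, EZ).prod 𝓘(ℝ, F)) 𝓘(ℝ, K.Space) K.feature
      (verticalLift EZ F D p).proj) :
    mfderiv (𝓘(ℝ, EZ).prod 𝓘(ℝ, F)) 𝓘(ℝ, K.Space) K.feature (verticalLift EZ F D p).proj
      (verticalLift EZ F D p).snd = K.fiberFeature p.1 p.2.2 := by
  have h1 := hasDerivAt_const_add_smul p.2.1 p.2.2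
  have h2 := ((K.fiberFeature p.1).restrictScalars ℝ).hasFDerivAt.comp_hasDerivAt (0 : ℝ) h1
  have h3 := hasMFDerivAt_unique (HasMFDerivAt.comp (0 : ℝ) h.hasMFDerivAt
    (hasMFDerivAt_verticalPath (EZ := EZ) (F := F) p).mdifferentiableAt.hasMFDerivAt)
    h2.hasFDerivAt.hasMFDerivAt
  exact (congrArg (fun L : ℝ →L[ℝ] K.Space ↦ L 1) h3).trans (one_smul ℝ _)

/-! ### The induced connection -/

/-- Since `K̂` is the composition of `δ_K` with `(S, x) ↦ x`, so are the differentials. -/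
theorem mfderiv_inclusion_tangentMap_classifyingMap (S₀ : Submodule ℂ K.Space) [CompleteSpace S₀]
    (hS₀ : ∀ s, ∃ u : unitary (K.Space →L[ℂ] K.Space), K.classifyingSubspace s = unitaryMap u S₀)
    (hK : K.IsAdmissible EZ)
    (v : TangentBundle (𝓘(ℝ, EZ).prod 𝓘(ℝ, F)) (TotalSpace F D)) :
    mfderiv (𝓘(ℝ, S₀ →L[ℂ] S₀ᗮ).prod 𝓘(ℝ, S₀)) 𝓘(ℝ, K.Space) inclusion
        (tangentMap (𝓘(ℝ, EZ).prod 𝓘(ℝ, F)) (𝓘(ℝ, S₀ →L[ℂ] S₀ᗮ).prod 𝓘(ℝ, S₀))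
          (K.classifyingMap S₀ hS₀) v).proj
        (tangentMap (𝓘(ℝ, EZ).prod 𝓘(ℝ, F)) (𝓘(ℝ, S₀ →L[ℂ] S₀ᗮ).prod 𝓘(ℝ, S₀))
          (K.classifyingMap S₀ hS₀) v).snd
      = mfderiv (𝓘(ℝ, EZ).prod 𝓘(ℝ, F)) 𝓘(ℝ, K.Space) K.feature v.proj v.snd := by
  have h := mfderiv_comp v.proj
    (hasMFDerivAt_inclusion (K.classifyingMap S₀ hS₀ v.proj)).mdifferentiableAt
    (K.mdifferentiableAt_classifyingMap S₀ hS₀ hK v.proj)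
  exact (congrArg (fun L : EZ × F →L[ℝ] K.Space ↦ L v.snd) h).symm

/-- Since `δ_K` covers `ζ_K`, its differential maps vertical vectors to vertical vectors. -/
theorem mfderiv_proj_tangentMap_classifyingMap (S₀ : Submodule ℂ K.Space) [CompleteSpace S₀]
    (hS₀ : ∀ s, ∃ u : unitary (K.Space →L[ℂ] K.Space), K.classifyingSubspace s = unitaryMap u S₀)
    (hK : K.IsAdmissible EZ)
    {v : TangentBundle (𝓘(ℝ, EZ).prod 𝓘(ℝ, F)) (TotalSpace F D)}
    (hv : (tangentMap (𝓘(ℝ, EZ).prod 𝓘(ℝ, F)) 𝓘(ℝ, EZ) TotalSpace.proj v).snd = 0) :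
    mfderiv (𝓘(ℝ, S₀ →L[ℂ] S₀ᗮ).prod 𝓘(ℝ, S₀)) 𝓘(ℝ, S₀ →L[ℂ] S₀ᗮ)
        (TotalSpace.proj : TotalSpace S₀ (Taut (S₀ := S₀)) → _)
        (tangentMap (𝓘(ℝ, EZ).prod 𝓘(ℝ, F)) (𝓘(ℝ, S₀ →L[ℂ] S₀ᗮ).prod 𝓘(ℝ, S₀))
          (K.classifyingMap S₀ hS₀) v).proj
        (tangentMap (𝓘(ℝ, EZ).prod 𝓘(ℝ, F)) (𝓘(ℝ, S₀ →L[ℂ] S₀ᗮ).prod 𝓘(ℝ, S₀))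
          (K.classifyingMap S₀ hS₀) v).snd = 0 := by
  have h1 := mfderiv_comp v.proj (hasMFDerivAt_proj (EB := S₀ →L[ℂ] S₀ᗮ)
    (K.classifyingMap S₀ hS₀ v.proj)).mdifferentiableAt
    (K.mdifferentiableAt_classifyingMap S₀ hS₀ hK v.proj)
  have h2 := mfderiv_comp v.proj
    (K.mdifferentiableAt_classifyingBase hK.smooth_classifying S₀ hS₀ v.proj.proj)
    (hasMFDerivAt_proj (EB := EZ) v.proj).mdifferentiableAt
  have h3 := congrArg (fun L : EZ × F →L[ℝ] (S₀ →L[ℂ] S₀ᗮ) ↦ L v.snd) (h1.symm.trans h2)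
  refine Eq.trans h3 ?_
  have h4 : mfderiv (𝓘(ℝ, EZ).prod 𝓘(ℝ, F)) 𝓘(ℝ, EZ) TotalSpace.proj v.proj v.snd = 0 := hv
  change mfderiv 𝓘(ℝ, EZ) 𝓘(ℝ, S₀ →L[ℂ] S₀ᗮ) (K.classifyingBase S₀ hS₀) v.proj.proj
    (mfderiv (𝓘(ℝ, EZ).prod 𝓘(ℝ, F)) 𝓘(ℝ, EZ) TotalSpace.proj v.proj v.snd) = 0
  rw [h4]
  exact ContinuousLinearMap.map_zero _

/-- The differential of `K̂` is injective on the vertical vectors at a point. -/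
theorem eq_of_mfderiv_feature_eq (hK : ∀ s, (K s s).IsInvertible)
    (hF : ∀ ξ, MDifferentiableAt (𝓘(ℝ, EZ).prod 𝓘(ℝ, F)) 𝓘(ℝ, K.Space) K.feature ξ)
    {v v' : TangentBundle (𝓘(ℝ, EZ).prod 𝓘(ℝ, F)) (TotalSpace F D)} (h : v.proj = v'.proj)
    (hv : (tangentMap (𝓘(ℝ, EZ).prod 𝓘(ℝ, F)) 𝓘(ℝ, EZ) TotalSpace.proj v).snd = 0)
    (hv' : (tangentMap (𝓘(ℝ, EZ).prod 𝓘(ℝ, F)) 𝓘(ℝ, EZ) TotalSpace.proj v').snd = 0)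
    (hvv : (mfderiv (𝓘(ℝ, EZ).prod 𝓘(ℝ, F)) 𝓘(ℝ, K.Space) K.feature v.proj v.snd : K.Space) =
      mfderiv (𝓘(ℝ, EZ).prod 𝓘(ℝ, F)) 𝓘(ℝ, K.Space) K.feature v'.proj v'.snd) : v = v' := by
  have h1 := exists_verticalLift_eq hv
  have h2 := exists_verticalLift_eq hv'
  rw [h] at h1
  generalize v'.proj = ξ at h1 h2
  obtain ⟨b, rfl⟩ := h1
  obtain ⟨b', rfl⟩ := h2
  rw [K.mfderiv_feature_verticalLift (hF _), K.mfderiv_feature_verticalLift (hF _)] at hvv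
  have hb : b = b' := K.fiberFeature_injective (hK _) hvv
  rw [hb]

/-- A vertical vector at the base point of `w` is mapped by the differential of `δ_K` to the value
of the universal connection at the image of `w` if and only if its image under the differential of
`K̂` is the orthogonal projection of that of `w`. -/
theorem tangentMap_classifyingMap_eq (S₀ : Submodule ℂ K.Space) [CompleteSpace S₀]
    (hS₀ : ∀ s, ∃ u : unitary (K.Space →L[ℂ] K.Space), K.classifyingSubspace s = unitaryMap u S₀)
    (hK : K.IsAdmissible EZ)
    {v w : TangentBundle (𝓘(ℝ, EZ).prod 𝓘(ℝ, F)) (TotalSpace F D)} (h : v.proj = w.proj)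
    (hv : (tangentMap (𝓘(ℝ, EZ).prod 𝓘(ℝ, F)) 𝓘(ℝ, EZ) TotalSpace.proj v).snd = 0) :
    tangentMap (𝓘(ℝ, EZ).prod 𝓘(ℝ, F)) (𝓘(ℝ, S₀ →L[ℂ] S₀ᗮ).prod 𝓘(ℝ, S₀))
        (K.classifyingMap S₀ hS₀) v = universalConnection S₀ (tangentMap (𝓘(ℝ, EZ).prod 𝓘(ℝ, F))
          (𝓘(ℝ, S₀ →L[ℂ] S₀ᗮ).prod 𝓘(ℝ, S₀)) (K.classifyingMap S₀ hS₀) w) ↔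
    (mfderiv (𝓘(ℝ, EZ).prod 𝓘(ℝ, F)) 𝓘(ℝ, K.Space) K.feature v.proj v.snd : K.Space) =
      (K.classifyingSubspace w.proj.proj).starProjection
        (mfderiv (𝓘(ℝ, EZ).prod 𝓘(ℝ, F)) 𝓘(ℝ, K.Space) K.feature w.proj w.snd : K.Space) := by
  have hι := K.mfderiv_inclusion_tangentMap_classifyingMap S₀ hS₀ hK
  have inst : (tangentMap (𝓘(ℝ, EZ).prod 𝓘(ℝ, F)) (𝓘(ℝ, S₀ →L[ℂ] S₀ᗮ).prod 𝓘(ℝ, S₀))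
      (K.classifyingMap S₀ hS₀) w).proj.proj.space.HasOrthogonalProjection :=
    inferInstanceAs (K.classifyingSubspace w.proj.proj).HasOrthogonalProjection
  have h1 := mfderiv_inclusion_universalConnection (tangentMap (𝓘(ℝ, EZ).prod 𝓘(ℝ, F))
    (𝓘(ℝ, S₀ →L[ℂ] S₀ᗮ).prod 𝓘(ℝ, S₀)) (K.classifyingMap S₀ hS₀) w)
  rw [hι w] at h1
  have h2 := K.mfderiv_proj_tangentMap_classifyingMap S₀ hS₀ hK hv
  have h3 := hι v
  have h4 : (tangentMap (𝓘(ℝ, EZ).prod 𝓘(ℝ, F)) (𝓘(ℝ, S₀ →L[ℂ] S₀ᗮ).prod 𝓘(ℝ, S₀))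
      (K.classifyingMap S₀ hS₀) v).proj = (tangentMap (𝓘(ℝ, EZ).prod 𝓘(ℝ, F))
        (𝓘(ℝ, S₀ →L[ℂ] S₀ᗮ).prod 𝓘(ℝ, S₀)) (K.classifyingMap S₀ hS₀) w).proj :=
    congrArg (K.classifyingMap S₀ hS₀) h
  constructor
  · intro h5
    rw [h5] at h3
    exact h3.symm.trans h1
  · intro h5
    exact tangentBundle_ext (h4.trans (universalConnection_proj _).symm)
      (h2.trans (mfderiv_proj_universalConnection _).symm) (h3.trans (Eq.trans h5 h1.symm))

/-- The induced connection sends `w ∈ T_ξ D` to the vertical vector at `ξ` whose image under the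
differential of `K̂` is the orthogonal projection to `ζ_K(Π(ξ))` of the image of `w`. -/
theorem inducedConnection_eq (S₀ : Submodule ℂ K.Space) [CompleteSpace S₀]
    (hS₀ : ∀ s, ∃ u : unitary (K.Space →L[ℂ] K.Space), K.classifyingSubspace s = unitaryMap u S₀)
    (hK : K.IsAdmissible EZ)
    (w : TangentBundle (𝓘(ℝ, EZ).prod 𝓘(ℝ, F)) (TotalSpace F D)) :
    K.inducedConnection EZ S₀ hS₀ w = verticalLift EZ F D ⟨w.proj.proj, w.proj.snd,
      (K w.proj.proj w.proj.proj).inverse (K.eval w.proj.proj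
        ((K.classifyingSubspace w.proj.proj).starProjection
          (mfderiv (𝓘(ℝ, EZ).prod 𝓘(ℝ, F)) 𝓘(ℝ, K.Space) K.feature w.proj w.snd : K.Space)))⟩ := by
  have hF := K.mdifferentiableAt_feature S₀ hS₀ hK
  obtain ⟨f, hf⟩ : ∃ f : K.Space, f = (K.classifyingSubspace w.proj.proj).starProjection
    (mfderiv (𝓘(ℝ, EZ).prod 𝓘(ℝ, F)) 𝓘(ℝ, K.Space) K.feature w.proj w.snd : K.Space) := ⟨_, rfl⟩
  rw [← hf]
  obtain ⟨v₀, hv₀⟩ : ∃ v₀, v₀ = verticalLift EZ F D ⟨w.proj.proj, w.proj.snd,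
    (K w.proj.proj w.proj.proj).inverse (K.eval w.proj.proj f)⟩ := ⟨_, rfl⟩
  have hproj₀ : v₀.proj = w.proj := by
    rw [hv₀]
    exact verticalLift_proj _
  have hvert₀ : (tangentMap (𝓘(ℝ, EZ).prod 𝓘(ℝ, F)) 𝓘(ℝ, EZ) TotalSpace.proj v₀).snd = 0 := by
    rw [hv₀]
    exact tangentMap_proj_verticalLift _
  have hv₀F : (mfderiv (𝓘(ℝ, EZ).prod 𝓘(ℝ, F)) 𝓘(ℝ, K.Space) K.feature v₀.proj v₀.snd : K.Space)
      = f := by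
    rw [hv₀, K.mfderiv_feature_verticalLift (hF _)]
    refine (K.fiberFeature_inverse_eval (hK.isInvertible _) f).trans ?_
    rw [hf]
    exact Submodule.starProjection_eq_self_iff.2 (Submodule.starProjection_apply_mem _ _)
  have hex : ∃ v ∈ {v : TangentBundle (𝓘(ℝ, EZ).prod 𝓘(ℝ, F)) (TotalSpace F D) |
      v.proj = w.proj ∧
      (tangentMap (𝓘(ℝ, EZ).prod 𝓘(ℝ, F)) 𝓘(ℝ, EZ) TotalSpace.proj v).snd = 0},
      tangentMap (𝓘(ℝ, EZ).prod 𝓘(ℝ, F)) (𝓘(ℝ, S₀ →L[ℂ] S₀ᗮ).prod 𝓘(ℝ, S₀))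
        (K.classifyingMap S₀ hS₀) v =
      universalConnection S₀ (tangentMap (𝓘(ℝ, EZ).prod 𝓘(ℝ, F))
        (𝓘(ℝ, S₀ →L[ℂ] S₀ᗮ).prod 𝓘(ℝ, S₀)) (K.classifyingMap S₀ hS₀) w) :=
    ⟨v₀, ⟨hproj₀, hvert₀⟩, (K.tangentMap_classifyingMap_eq S₀ hS₀ hK hproj₀ hvert₀).2
      (hv₀F.trans hf)⟩
  -- The induced connection is defined by `Function.invFunOn`, whose value is a preimage by `hex`.
  have : Nonempty (TangentBundle (𝓘(ℝ, EZ).prod 𝓘(ℝ, F)) (TotalSpace F D)) := ⟨w⟩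
  obtain ⟨hproj, hvert⟩ := Function.invFunOn_mem hex
  have heq := (K.tangentMap_classifyingMap_eq S₀ hS₀ hK hproj hvert).1 (Function.invFunOn_eq hex)
  rw [← hv₀]
  exact K.eq_of_mfderiv_feature_eq hK.isInvertible hF (hproj.trans hproj₀.symm) hvert hvert₀
    (heq.trans (hf.symm.trans hv₀F.symm))

end ReproducingKernel

end Kernel

end KernelConnection
end

theorem theorem4p2
    {EZ : Type*} [NormedAddCommGroup EZ] [NormedSpace ℝ EZ] [CompleteSpace EZ]
    {Z : Type*} [TopologicalSpace Z] [ChartedSpace EZ Z] [IsManifold 𝓘(ℝ, EZ) ∞ Z]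
    {F : Type*} [NormedAddCommGroup F] [InnerProductSpace ℂ F] [CompleteSpace F]
    {D : Z → Type*} [TopologicalSpace (TotalSpace F D)]
    [∀ z, NormedAddCommGroup (D z)] [∀ z, InnerProductSpace ℂ (D z)] [∀ z, CompleteSpace (D z)]
    [FiberBundle F D] [VectorBundle ℂ F D] [VectorBundle ℝ F D]
    [ContMDiffVectorBundle ∞ F D 𝓘(ℝ, EZ)] (hD : IsHermitianBundle EZ F D)
    (K : ReproducingKernel F D) (hK : K.IsAdmissible EZ)
    (S₀ : Submodule ℂ K.Space) [CompleteSpace S₀]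
    (hS₀ : ∀ s, ∃ u : unitary (K.Space →L[ℂ] K.Space), K.classifyingSubspace s = unitaryMap u S₀)
    (W : Set Z) (hW : IsOpen W) (σ : ∀ z, D z)
    (hσ : ContMDiffOn 𝓘(ℝ, EZ) (𝓘(ℝ, EZ).prod 𝓘(ℝ, F)) ∞
      (fun z ↦ (⟨z, σ z⟩ : TotalSpace F D)) W)
    (V : Set (GrassmannComponent S₀)) (hV : IsOpen V)
    (τ : ∀ S : GrassmannComponent S₀, GrassmannComponent.Taut S)
    (hτ : ContMDiffOn 𝓘(ℝ, S₀ →L[ℂ] S₀ᗮ) (𝓘(ℝ, S₀ →L[ℂ] S₀ᗮ).prod 𝓘(ℝ, S₀)) ∞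
      (fun S ↦ (⟨S, τ S⟩ : TotalSpace S₀ (GrassmannComponent.Taut (S₀ := S₀)))) V)
    (hστ : ∀ s ∈ W, K.classifyingBase S₀ hS₀ s ∈ V →
      K.classifyingMap S₀ hS₀ ⟨s, σ s⟩
        = ⟨K.classifyingBase S₀ hS₀ s, τ (K.classifyingBase S₀ hS₀ s)⟩)
    (s : Z) (hsW : s ∈ W) (hsV : K.classifyingBase S₀ hS₀ s ∈ V)
    (X : TangentSpace 𝓘(ℝ, EZ) s) :
    MDifferentiableAt 𝓘(ℝ, EZ) 𝓘(ℝ, K.Space) (fun z ↦ K.feature ⟨z, σ z⟩) s ∧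
      covariantDerivative (K.inducedConnection EZ S₀ hS₀) σ ⟨s, X⟩
        = ⟨s, (K s s).inverse
            (K.eval s ((K.classifyingSubspace s).starProjection (K.dFeature EZ σ s X)))⟩ := by
  have hF := K.mdifferentiableAt_feature S₀ hS₀ hK
  have hσs := (hσ.contMDiffAt (hW.mem_nhds hsW)).mdifferentiableAt (by simp)
  refine ⟨(hF _).comp s hσs, ?_⟩
  have hd : (mfderiv (𝓘(ℝ, EZ).prod 𝓘(ℝ, F)) 𝓘(ℝ, K.Space) K.feature ⟨s, σ s⟩
      (mfderiv 𝓘(ℝ, EZ) (𝓘(ℝ, EZ).prod 𝓘(ℝ, F)) (fun z ↦ (⟨z, σ z⟩ : TotalSpace F D)) s X) :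
      K.Space) = K.dFeature EZ σ s X :=
    congrArg (fun L : EZ →L[ℝ] K.Space ↦ L X) (mfderiv_comp s (hF ⟨s, σ s⟩) hσs).symm
  rw [covariantDerivative, K.inducedConnection_eq S₀ hS₀ hK, verticalProj_verticalLift]
  exact congrArg (fun f : K.Space ↦ (⟨s, (K s s).inverse
    (K.eval s ((K.classifyingSubspace s).starProjection f))⟩ : TotalSpace F D)) hd
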